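/- The finite synthesis problem for the interval temporal logic $A\bar AB\bar B$ is undecidable, in the following sense. \textbf{Logic.} Formulas are built from proposition letters $a$ by $\neg$, $\vee$ and the unary modalities $\langle A\rangle,\langle\bar A\rangle,\langle B\rangle,\langle\bar B\rangle$. Over a linear order $D$ with a valuation $\mathcal V$ that assigns a set of proposition letters to each closed interval $[x,y]$, $x\le y$ in $D$, they are interpreted by: $[x,y]\models a$ iff $a\in\mathcal V([x,y])$; the Boolean connectives as usual; and $[x,y]\models\langle R\rangle\psi$ iff $[x',y']\models\psi$ for some interval $[x',y']$ with, respectively, $y=x'$ (for $A$); $x=y'$ (for $\bar A$); $x=x'$ and $y'<y$ (for $B$); $x=x'$ and $y<y'$ (for $\bar B$). For a formula $\varphi$ let $\Sigma$ be the set of proposition letters occurring in $\varphi$, and let $TF(\varphi)$ be the set of its temporal requests, i.e. of all subformulas of $\varphi$ (including $\varphi$) of the form $\langle R\rangle\psi$ with $R\in\{A,\bar A,B,\bar B\}$. \textbf{Game.} Let $\Theta\subseteq TF(\varphi)$, let $\Sigma^T=\Sigma\cup\Theta$, and let $\Sigma^T_\Box\subseteq\Sigma^T$. In each round Spoiler picks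 an interval $[x,y]$ of $\mathbb N$ and a set $\sigma\subseteq\Sigma^T_\Box$, and Duplicator answers with a set $\sigma'\subseteq\Sigma^T\setminus\Sigma^T_\Box$ for the same interval. The first interval is $[0,0]$; no interval is picked twice; when the right endpoint changes from one round to the next it increases by exactly $1$, and all intervals with a smaller right endpoint than the new one must already have been picked. An infinite admissible run is an infinite play in which every interval of $\mathbb N$ is picked. The first $m(m+1)/2$ rounds ($m\ge 1$) of an infinite admissible run label exactly the intervals over $D=\{0,\dots,m-1\}$. They are \emph{successful} if, with $\mathcal V([x,y])=(\sigma\cup\sigma')\cap\Sigma$ for the labels $\sigma,\sigma'$ put on $[x,y]$, one has $(D,\mathcal V),[0,0]\models\varphi$, and for all intervals $[x,y]$ over $D$ and all $\psi\in\Theta$: $(D,\mathcal V),[x,y]\models\psi$ iff $\psi\in\sigma\cup\sigma'$. A strategy of Duplicator is a function from the finite plays that end with a move of Spoiler to subsets of $\Sigma^T\setminus\Sigma^T_\Box$. The pair $(\varphi,\Sigma^T_\Box)$ \emph{admits a finite synthesis with respect to $\Theta$} if there is a strategy such that, for every sequence of Spoiler's moves in an infinite admissible run, the response of the strategy to that sequence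 has, for some $m\ge1$, a successful initial part of $m(m+1)/2$ rounds. \textbf{Theorem.} There is no algorithm that, given an $A\bar AB\bar B$-formula $\varphi$ and a finite set $\Sigma^T_\Box\subseteq\Sigma\cup TF(\varphi)$, decides whether $(\varphi,\Sigma^T_\Box)$ admits a finite synthesis with respect to $\Theta=TF(\varphi)$. Likewise, there is no algorithm that, given $\varphi$ and a finite set $\Sigma^T_\Box\subseteq\Sigma$, decides whether $(\varphi,\Sigma^T_\Box)$ admits a finite synthesis with respect to $\Theta=\emptyset$, that is, for the game on proposition letters alone, in which Duplicator wins as soon as the induced structure on some $\{0,\dots,m-1\}$ is a model of $\varphi$. -/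

import Mathlib

namespace IntervalSynthesis

/-- Formulas of the interval temporal logic `A Ā B B̄`, over the proposition letters `0, 1, 2, …`. -/
inductive Formula : Type
  | letter : ℕ → Formula
  | neg : Formula → Formula
  | or : Formula → Formula → Formula
  | diaA : Formula → Formula
  | diaAbar : Formula → Formula
  | diaB : Formula → Formula
  | diaBbar : Formula → Formula

namespace Formula

/-- Goedel numbering of formulas. -/
def toNat : Formula → ℕ
  | letter a => 7 * a
  | neg ψ => 7 * ψ.toNat + 1
  | or ψ χ => 7 * Nat.pair ψ.toNat χ.toNat + 2
  | diaA ψ => 7 * ψ.toNat + 3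
  | diaAbar ψ => 7 * ψ.toNat + 4
  | diaB ψ => 7 * ψ.toNat + 5
  | diaBbar ψ => 7 * ψ.toNat + 6

/-- The formula with a given number. -/
def ofNat (n : ℕ) : Formula :=
  if _h0 : n % 7 = 0 then letter (n / 7)
  else if _h1 : n % 7 = 1 then neg (ofNat (n / 7))
  else if _h2 : n % 7 = 2 then
    or (ofNat (n / 7).unpair.1) (ofNat (n / 7).unpair.2)
  else if _h3 : n % 7 = 3 then diaA (ofNat (n / 7))
  else if _h4 : n % 7 = 4 then diaAbar (ofNat (n / 7))
  else if _h5 : n % 7 = 5 then diaB (ofNat (n / 7))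
  else diaBbar (ofNat (n / 7))
termination_by n
decreasing_by
  all_goals
    have h1 := Nat.unpair_left_le (n / 7)
    have h2 := Nat.unpair_right_le (n / 7)
    omega

theorem ofNat_toNat (φ : Formula) : ofNat φ.toNat = φ := by
  induction φ with
  | letter a => rw [toNat, ofNat]; simp
  | neg ψ ih =>
    rw [toNat, ofNat]
    simp [show (7 * ψ.toNat + 1) / 7 = ψ.toNat by omega, Nat.add_mod, ih]
  | or ψ χ ih1 ih2 =>
    rw [toNat, ofNat]
    simp [show (7 * Nat.pair ψ.toNat χ.toNat + 2) / 7 = Nat.pair ψ.toNat χ.toNat by omega,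
      Nat.add_mod, ih1, ih2]
  | diaA ψ ih =>
    rw [toNat, ofNat]
    simp [show (7 * ψ.toNat + 3) / 7 = ψ.toNat by omega, Nat.add_mod, ih]
  | diaAbar ψ ih =>
    rw [toNat, ofNat]
    simp [show (7 * ψ.toNat + 4) / 7 = ψ.toNat by omega, Nat.add_mod, ih]
  | diaB ψ ih =>
    rw [toNat, ofNat]
    simp [show (7 * ψ.toNat + 5) / 7 = ψ.toNat by omega, Nat.add_mod, ih]
  | diaBbar ψ ih =>
    rw [toNat, ofNat]
    simp [show (7 * ψ.toNat + 6) / 7 = ψ.toNat by omega, Nat.add_mod, ih]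

theorem toNat_ofNat (n : ℕ) : (ofNat n).toNat = n := by
  induction n using Nat.strong_induction_on with
  | _ n ih =>
    have h1 := Nat.unpair_left_le (n / 7)
    have h2 := Nat.unpair_right_le (n / 7)
    rw [ofNat]
    split_ifs with h0 h1 h2 h3 h4 h5 <;> simp only [toNat]
    · omega
    · rw [ih _ (by omega)]; omega
    · rw [ih _ (by omega), ih _ (by omega), Nat.pair_unpair]; omega
    · rw [ih _ (by omega)]; omega
    · rw [ih _ (by omega)]; omega
    · rw [ih _ (by omega)]; omega
    · rw [ih _ (by omega)]; omega

/-- The numbering makes formulas (hence pairs and lists of them) inputs of algorithms. -/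
instance instDenumerable : Denumerable Formula :=
  Denumerable.mk' ⟨toNat, ofNat, ofNat_toNat, toNat_ofNat⟩

/-- The subformulas of a formula, itself included. -/
def subformulas : Formula → Set Formula
  | letter a => {letter a}
  | neg ψ => {neg ψ} ∪ subformulas ψ
  | or ψ χ => {or ψ χ} ∪ subformulas ψ ∪ subformulas χ
  | diaA ψ => {diaA ψ} ∪ subformulas ψ
  | diaAbar ψ => {diaAbar ψ} ∪ subformulas ψ
  | diaB ψ => {diaB ψ} ∪ subformulas ψ
  | diaBbar ψ => {diaBbar ψ} ∪ subformulas ψ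

/-- The formulas of the form `⟨R⟩ ψ`, with `R` one of `A`, `Ā`, `B`, `B̄`. -/
def IsRequest (χ : Formula) : Prop :=
  ∃ ψ, χ = diaA ψ ∨ χ = diaAbar ψ ∨ χ = diaB ψ ∨ χ = diaBbar ψ

/-- The proposition letters that occur in `φ`, as atomic formulas. -/
def letters (φ : Formula) : Set Formula := {ψ ∈ subformulas φ | ∃ a, ψ = letter a}

/-- The temporal requests of `φ`: the members `⟨R⟩ ψ` of its closure. (A closure consists of the
subformulas and their negations, up to the identification of `¬¬ψ` with `ψ`; the negations
contribute no further formula `⟨R⟩ ψ`.) -/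
def requests (φ : Formula) : Set Formula := {ψ ∈ subformulas φ | IsRequest ψ}

/-- `V, I ⊨ φ`, for an interval structure with linear order `D` and valuation `V`; the intervals
are the `[x, y]` with `x ≤ y`, points included. -/
def Sat {D : Type*} [LinearOrder D] (V : NonemptyInterval D → Set ℕ) :
    NonemptyInterval D → Formula → Prop
  | I, letter a => a ∈ V I
  | I, neg ψ => ¬ Sat V I ψ
  | I, or ψ χ => Sat V I ψ ∨ Sat V I χ
  | I, diaA ψ => ∃ J : NonemptyInterval D, I.snd = J.fst ∧ Sat V J ψ
  | I, diaAbar ψ => ∃ J : NonemptyInterval D, I.fst = J.snd ∧ Sat V J ψ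
  | I, diaB ψ => ∃ J : NonemptyInterval D, (I.fst = J.fst ∧ J.snd < I.snd) ∧ Sat V J ψ
  | I, diaBbar ψ => ∃ J : NonemptyInterval D, (I.fst = J.fst ∧ I.snd < J.snd) ∧ Sat V J ψ

end Formula

/-- One entry `([x, y], σ)` of a run. -/
abbrev Move : Type := NonemptyInterval ℕ × Set Formula

/-- The labels that are used in the game for `φ` when the players also declare the truth values of
the temporal requests in `Θ`. -/
def alphabet (Θ : Set Formula) (φ : Formula) : Set Formula := φ.letters ∪ Θ

/-- The rules of the game for a sequence `ρ 0, ρ 1, …` of length `N` (finite or infinite), where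
`S` is the whole alphabet and `P` is Spoiler's part of it. -/
structure Rules (S P : Set Formula) (N : ℕ∞) (ρ : ℕ → Move) : Prop where
  /-- The play starts on the interval `[0, 0]`. -/
  start : (ρ 0).1 = NonemptyInterval.pure 0
  /-- Duplicator answers each move of Spoiler, on the same interval. -/
  answer : ∀ i : ℕ, Even i → (i : ℕ∞) < N → ((i + 1 : ℕ) : ℕ∞) < N ∧ (ρ i).1 = (ρ (i + 1)).1
  /-- Spoiler's labels. -/
  spoiler : ∀ i : ℕ, Even i → (i : ℕ∞) < N → (ρ i).2 ⊆ P
  /-- Duplicator's labels. -/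
  duplicator : ∀ i : ℕ, Even i → (i : ℕ∞) < N → (ρ (i + 1)).2 ⊆ S \ P
  /-- No interval is labelled in two different rounds. -/
  once : ∀ i j : ℕ, Even i → (i : ℕ∞) < N → (j : ℕ∞) < N → j ≠ i → j ≠ i + 1 → (ρ i).1 ≠ (ρ j).1
  /-- The right endpoint may only grow by one, and only when all intervals with smaller right
  endpoints have been labelled. -/
  order : ∀ i : ℕ, ((i + 1 : ℕ) : ℕ∞) < N → (ρ (i + 1)).1.snd ≠ (ρ i).1.snd →
    (ρ (i + 1)).1.snd = (ρ i).1.snd + 1 ∧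
      ∀ I : NonemptyInterval ℕ, I.snd < (ρ (i + 1)).1.snd → ∃ j < i + 1, (ρ j).1 = I

/-- A finite admissible run over the points `0, …, k`. These points have `(k + 1) * (k + 2) / 2`
intervals, and each of them is treated by one move of each player. -/
def FiniteRun (S P : Set Formula) (k : ℕ) (ρ : ℕ → Move) : Prop :=
  Rules S P ((k + 1) * (k + 2) : ℕ) ρ ∧
    ∀ I : NonemptyInterval ℕ, I.snd ≤ k → ∃ i < (k + 1) * (k + 2), (ρ i).1 = I

/-- An infinite admissible run. -/
def InfiniteRun (S P : Set Formula) (ρ : ℕ → Move) : Prop :=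
  Rules S P ⊤ ρ ∧ ∀ I : NonemptyInterval ℕ, ∃ i, (ρ i).1 = I

/-- The list `ρ 0, …, ρ (n - 1)`. -/
def initialSegment (ρ : ℕ → Move) (n : ℕ) : List Move := (List.range n).map ρ

/-- The prefixes of odd length of finite and infinite admissible runs: here it is Duplicator's
turn. -/
def positions (S P : Set Formula) : Set (List Move) :=
  {h | ∃ (ρ : ℕ → Move) (n : ℕ), Odd n ∧ h = initialSegment ρ n ∧
    (InfiniteRun S P ρ ∨ ∃ k, n ≤ (k + 1) * (k + 2) ∧ FiniteRun S P k ρ)}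

/-- The sequences of all moves of Spoiler in an infinite admissible run. -/
def spoilerRuns (S P : Set Formula) : Set (ℕ → Move) :=
  {τ | ∃ ρ, InfiniteRun S P ρ ∧ ∀ i, ρ (2 * i) = τ i}

/-- A response strategy of Duplicator (its values outside `positions S P` are irrelevant). -/
def IsStrategy (S P : Set Formula) (f : List Move → Set Formula) : Prop :=
  ∀ h ∈ positions S P, f h ⊆ S \ P

/-- The sequence `ρ` is the response of the strategy `f` to the sequence `τ` of Spoiler's moves. -/
def IsResponse (f : List Move → Set Formula) (τ ρ : ℕ → Move) : Prop :=
  ∀ i, ρ (2 * i) = τ i ∧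
    ρ (2 * i + 1) = ((ρ (2 * i)).1, f (initialSegment ρ (2 * i + 1)))

/-- Everything that the two players put on the interval `I` in the first `N` entries of `ρ`. -/
def labelling (ρ : ℕ → Move) (N : ℕ) (I : NonemptyInterval ℕ) : Set Formula :=
  {ψ | ∃ i, Even i ∧ i < N ∧ (ρ i).1 = I ∧ (ψ ∈ (ρ i).2 ∨ ψ ∈ (ρ (i + 1)).2)}

/-- An interval over the points `0, …, k`, as an interval over the natural numbers. -/
def toNatInterval {k : ℕ} (I : NonemptyInterval (Fin (k + 1))) : NonemptyInterval ℕ :=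
  ⟨(I.fst.val, I.snd.val), I.fst_le_snd⟩

/-- The valuation of the interval structure over `0, …, k` that is induced by a finite run. -/
def inducedValuation (ρ : ℕ → Move) (k : ℕ) (I : NonemptyInterval (Fin (k + 1))) : Set ℕ :=
  {a | Formula.letter a ∈ labelling ρ ((k + 1) * (k + 2)) (toNatInterval I)}

/-- The first `(k + 1) * (k + 2)` entries of `ρ` form a successful admissible run: the induced
structure satisfies `φ` on `[0, 0]`, and all requests in `Θ` have been declared correctly. -/
def Successful (Θ : Set Formula) (φ : Formula) (P : Set Formula) (k : ℕ) (ρ : ℕ → Move) : Prop :=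
  FiniteRun (alphabet Θ φ) P k ρ ∧
    Formula.Sat (inducedValuation ρ k) (NonemptyInterval.pure 0) φ ∧
    ∀ (I : NonemptyInterval (Fin (k + 1))), ∀ ψ ∈ Θ,
      Formula.Sat (inducedValuation ρ k) I ψ ↔
        ψ ∈ labelling ρ ((k + 1) * (k + 2)) (toNatInterval I)

/-- `(φ, P)` is an instance (Spoiler controls a part `P` of the alphabet) that admits a finite
synthesis, for the game in which the truth values of the requests in `Θ` are declared. -/
def FiniteSynthesis (Θ : Set Formula) (φ : Formula) (P : Set Formula) : Prop :=
  P ⊆ alphabet Θ φ ∧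
    ∃ f, IsStrategy (alphabet Θ φ) P f ∧
      ∀ τ ∈ spoilerRuns (alphabet Θ φ) P,
        ∃ ρ, IsResponse f τ ρ ∧ ∃ k, Successful Θ φ P k ρ

end IntervalSynthesis

/-! The halting problem is reduced to finite synthesis. One counter machine `P` is fixed; started
with the code of a program plus one in its counter `0`, it halts iff that program does. Only the
conjunct `input n` of the formula depends on the code. A model over `{0, …, k}` describes a run of
`P`: the point interval `[y, y]` carries the address at time `y`, an increment at time `x` creates a
thread `x`, and a decrement at time `y` consumes a thread `x` by putting `kill` on `[x, y]`. The
value of a counter is the number of its live threads.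

The formula `lawful` says all this, except that a decrement consumes at most one thread. Spoiler's
only letter `mark` closes the gap: `unmixed` forbids that, of the threads consumed at one time, one
is marked and another is not. Spoiler labels the intervals with right endpoint `y` from left to
right and marks those that have an interval with `kill` to their left. If Duplicator consumes
several threads, the leftmost is unmarked and the others are marked, so `unmixed` fails one time
unit later. Hence a winning strategy yields a halting run (`exists_halting_of_holds_spec`,
`exists_halting_of_finiteSynthesis`). Conversely, the labels of an honest halting run satisfy the
formula under all marks (`exists_labels_of_halting`).

If requests are declared too, Duplicator must know their truth values before the remaining marks are
played. This is why `killedWith` inspects marks with a delay of one: in the honest model every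
request depends only on marks on intervals with a smaller right endpoint, which have all been played
(`predictable_spec`). From this `finiteSynthesis_of_labels` builds the strategy, for any set of
declared requests, so that both claims follow from `not_computablePred_finiteSynthesis`. -/

namespace IntervalSynthesis

/-! ### Counter machines. -/

/-- Instructions of a counter machine: `inc r` increments the counter `r`; `dec r j` jumps to `j` if
the counter `r` is zero and decrements it otherwise. -/
inductive Instr : Type
  | inc : ℕ → Instr
  | dec : ℕ → ℕ → Instr
  deriving DecidableEq

/-- One step of a counter machine; a machine that has left its program stays where it is. -/
def step (P : List Instr) (c : ℕ × (ℕ → ℕ)) : ℕ × (ℕ → ℕ) :=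
  match P[c.1]? with
  | none => c
  | some (.inc r) => (c.1 + 1, Function.update c.2 r (c.2 r + 1))
  | some (.dec r j) =>
    if c.2 r = 0 then (j, c.2) else (c.1 + 1, Function.update c.2 r (c.2 r - 1))

theorem step_inc {P : List Instr} {l r : ℕ} (h : P[l]? = some (.inc r)) (s : ℕ → ℕ) :
    step P (l, s) = (l + 1, Function.update s r (s r + 1)) := by
  simp [step, h]

theorem step_dec_zero {P : List Instr} {l r j : ℕ} (h : P[l]? = some (.dec r j)) {s : ℕ → ℕ}
    (hs : s r = 0) : step P (l, s) = (j, s) := by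
  simp [step, h, hs]

theorem step_dec_pos {P : List Instr} {l r j : ℕ} (h : P[l]? = some (.dec r j)) {s : ℕ → ℕ}
    (hs : s r ≠ 0) : step P (l, s) = (l + 1, Function.update s r (s r - 1)) := by
  simp [step, h, hs]

/-! ### Loop programs and their compilation to counter machines. -/

/-- Structured programs with loops; `loop r p` is `while r ≠ 0 do (r := r - 1; p)`. -/
inductive Loop : Type
  | skip : Loop
  | inc : ℕ → Loop
  | seq : Loop → Loop → Loop
  | loop : ℕ → Loop → Loop

namespace Loop

/-- The state transformation of a program whose loop bodies preserve their loop counters. -/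
def run : Loop → (ℕ → ℕ) → (ℕ → ℕ)
  | skip, s => s
  | inc r, s => Function.update s r (s r + 1)
  | seq p q, s => run q (run p s)
  | loop r p, s => (fun u => run p (Function.update u r (u r - 1)))^[s r] s

/-- Loop bodies preserve their loop counters, and the register `z` is never incremented. -/
def WF (z : ℕ) : Loop → Prop
  | skip => True
  | inc r => r ≠ z
  | seq p q => WF z p ∧ WF z q
  | loop r p => (∀ s, run p s r = s r) ∧ WF z p

/-- The number of instructions of a compiled program. -/
def size : Loop → ℕ
  | skip => 0
  | inc _ => 1
  | seq p q => size p + size q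
  | loop _ p => size p + 2

/-- Compilation to a counter machine whose register `z` is always zero; the program is placed at
the address `b`. -/
def compile (z : ℕ) : Loop → ℕ → List Instr
  | skip, _ => []
  | inc r, _ => [.inc r]
  | seq p q, b => compile z p b ++ compile z q (b + size p)
  | loop r p, b => .dec r (b + size p + 2) :: (compile z p (b + 1) ++ [.dec z b])

theorem length_compile (z : ℕ) (p : Loop) (b : ℕ) : (compile z p b).length = size p := by
  induction p generalizing b with
  | skip => rfl
  | inc r => rfl
  | seq p q hp hq => simp [compile, size, hp, hq]
  | loop r p hp => simp [compile, size, hp]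

/-- What matters later is that no jump leads to the address `0`, which is reserved for the input
phase, or beyond the end of the program. -/
theorem jump_of_mem_compile {z : ℕ} {p : Loop} {b r j : ℕ}
    (h : Instr.dec r j ∈ compile z p b) : b ≤ j ∧ j ≤ b + size p := by
  induction p generalizing b with
  | skip => simp [compile] at h
  | inc r => simp [compile] at h
  | seq p q hp hq =>
    simp only [compile, List.mem_append] at h
    simp only [size]
    rcases h with h | h
    · have := hp h; omega
    · have := hq h; omega
  | loop r p hp =>
    simp only [compile, List.mem_cons, List.mem_append, Instr.dec.injEq, List.not_mem_nil,
      or_false] at h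
    simp only [size]
    rcases h with h | h | h
    · omega
    · have := hp h; omega
    · omega

/-- Since `z` stays zero, `dec z b` serves as an unconditional jump. -/
theorem run_eq_zero {z : ℕ} {p : Loop} (hp : WF z p) {s : ℕ → ℕ} (hs : s z = 0) :
    run p s z = 0 := by
  induction p generalizing s with
  | skip => exact hs
  | inc r =>
    simp only [WF] at hp
    simp [run, Function.update_of_ne hp.symm, hs]
  | seq p q ihp ihq => exact ihq hp.2 (ihp hp.1 hs)
  | loop r p ih =>
    have h : ∀ (t : ℕ) (u : ℕ → ℕ), u z = 0 →
        (fun u => run p (Function.update u r (u r - 1)))^[t] u z = 0 := by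
      intro t
      induction t with
      | zero => exact fun u hu => hu
      | succ t iht =>
        intro u hu
        rw [Function.iterate_succ_apply]
        refine iht _ (ih hp.2 ?_)
        by_cases h : z = r
        · subst h; simp [hu]
        · simp [Function.update_of_ne h, hu]
    exact h _ _ hs

/-- The code `C` occurs in the program `P` at the address `b`. -/
def Occurs (C : List Instr) (P : List Instr) (b : ℕ) : Prop :=
  ∀ i c, C[i]? = some c → P[b + i]? = some c

theorem Occurs.left {C D P : List Instr} {b : ℕ} (h : Occurs (C ++ D) P b) : Occurs C P b := by
  intro i c hc
  refine h i c ?_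
  rw [List.getElem?_append_left, hc]
  exact (List.getElem?_eq_some_iff.1 hc).1

theorem Occurs.right {C D P : List Instr} {b : ℕ} (h : Occurs (C ++ D) P b) :
    Occurs D P (b + C.length) := by
  intro i c hc
  rw [add_assoc]
  refine h _ c ?_
  rw [List.getElem?_append_right (by omega)]
  simpa using hc

/-- For a loop, an inner induction on the counter: the body hands the counter back unchanged, so
each pass lowers it by exactly one, and the closing `dec z b` always jumps back. -/
theorem exists_iterate_step {z : ℕ} {P : List Instr} {p : Loop} (hp : WF z p) {b : ℕ}
    (h : Occurs (compile z p b) P b) {s : ℕ → ℕ} (hs : s z = 0) :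
    ∃ t, (step P)^[t] (b, s) = (b + size p, run p s) := by
  induction p generalizing b s with
  | skip => exact ⟨0, rfl⟩
  | inc r => exact ⟨1, step_inc (by simpa using h 0 (.inc r) rfl) s⟩
  | seq p q ihp ihq =>
    obtain ⟨t, ht⟩ := ihp hp.1 h.left hs
    have h2 := h.right
    rw [length_compile] at h2
    obtain ⟨u, hu⟩ := ihq hp.2 h2 (run_eq_zero hp.1 hs)
    refine ⟨u + t, ?_⟩
    rw [Function.iterate_add_apply, ht, hu]
    simp [size, run, add_assoc]
  | loop r p ih =>
    have h0 : P[b]? = some (.dec r (b + size p + 2)) := by simpa using h 0 _ rfl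
    have h' : Occurs ([.dec r (b + size p + 2)] ++ (compile z p (b + 1) ++ [.dec z b])) P b := h
    have h1 : Occurs (compile z p (b + 1)) P (b + 1) := h'.right.left
    have h2 : P[b + 1 + size p]? = some (.dec z b) := by
      have := h'.right.right 0 _ rfl
      simpa [length_compile] using this
    have key : ∀ (n : ℕ) (u : ℕ → ℕ), u r = n → u z = 0 → ∃ t, (step P)^[t] (b, u) =
        (b + size p + 2, (fun u => run p (Function.update u r (u r - 1)))^[n] u) := by
      intro n
      induction n with
      | zero => exact fun u hu _ => ⟨1, step_dec_zero h0 hu⟩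
      | succ n ihn =>
        intro u hu hz
        have hzr : z ≠ r := by rintro rfl; omega
        have hz' : Function.update u r (u r - 1) z = 0 := by
          rw [Function.update_of_ne hzr, hz]
        obtain ⟨t, ht⟩ := ih hp.2 h1 hz'
        obtain ⟨t', ht'⟩ := ihn (run p (Function.update u r (u r - 1)))
          (by rw [hp.1]; simp [hu]) (run_eq_zero hp.2 hz')
        refine ⟨t' + (1 + (t + 1)), ?_⟩
        rw [Function.iterate_add_apply, Function.iterate_add_apply _ 1,
          Function.iterate_add_apply _ t, Function.iterate_one,
          step_dec_pos h0 (by omega), ht, step_dec_zero h2 (run_eq_zero hp.2 hz'), ht',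
          Function.iterate_succ_apply]
    obtain ⟨t, ht⟩ := key _ s rfl hs
    exact ⟨t, ht⟩

theorem run_loop_zero {r : ℕ} {p : Loop} {s : ℕ → ℕ} (hs : s r = 0) : run (loop r p) s = s := by
  rw [run, hs, Function.iterate_zero_apply]

theorem run_loop_succ {r : ℕ} {p : Loop} {s : ℕ → ℕ} (hp : ∀ s, run p s r = s r) (hs : s r ≠ 0) :
    run (loop r p) s = run (loop r p) (run p (Function.update s r (s r - 1))) := by
  obtain ⟨n, hn⟩ := Nat.exists_eq_succ_of_ne_zero hs
  rw [run, run, hp, hn, Function.iterate_succ_apply]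
  simp [hn]

/-! ### Primitive recursive functions as loop programs. -/

/-- Set a register to zero. -/
def clear (r : ℕ) : Loop := loop r skip

theorem run_clear (r : ℕ) (s : ℕ → ℕ) : run (clear r) s = Function.update s r 0 := by
  have h : ∀ (n : ℕ) (u : ℕ → ℕ), u r = n → run (clear r) u = Function.update u r 0 := by
    intro n
    induction n with
    | zero => intro u hu; rw [clear, run_loop_zero hu, ← hu, Function.update_eq_self]
    | succ n ih =>
      intro u hu
      rw [clear, run_loop_succ (fun _ => rfl) (by omega)]
      simp only [run]
      exact (ih _ (by simp [hu])).trans (by simp)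
  exact h _ s rfl

/-- Copy the register `r` to `t`, with the help of `u`. -/
def copy (t r u : ℕ) : Loop :=
  seq (clear t) (seq (clear u) (seq (loop r (seq (inc t) (inc u))) (loop u (inc r))))

theorem run_copy {t r u : ℕ} (htr : t ≠ r) (htu : t ≠ u) (hru : r ≠ u) (s : ℕ → ℕ) :
    run (copy t r u) s = Function.update (Function.update s u 0) t (s r) := by
  have h1 : ∀ (n : ℕ) (v : ℕ → ℕ), v r = n → run (loop r (seq (inc t) (inc u))) v =
      Function.update (Function.update (Function.update v t (v t + n)) u (v u + n)) r 0 := by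
    intro n
    induction n with
    | zero =>
      intro v hv
      rw [run_loop_zero hv]
      funext i
      simp only [Function.update_apply]
      split_ifs <;> simp_all
    | succ n ih =>
      intro v hv
      rw [run_loop_succ (fun v => by simp [run, Function.update, htr.symm, hru]) (by omega),
        ih _ (by simp [run, Function.update, htr.symm, hru, hv])]
      funext i
      simp only [run, Function.update_apply]
      split_ifs <;> simp_all <;> omega
  have h2 : ∀ (n : ℕ) (v : ℕ → ℕ), v u = n → run (loop u (inc r)) v =
      Function.update (Function.update v r (v r + n)) u 0 := by
    intro n
    induction n with
    | zero =>
      intro v hv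
      rw [run_loop_zero hv]
      funext i
      simp only [Function.update_apply]
      split_ifs <;> simp_all
    | succ n ih =>
      intro v hv
      rw [run_loop_succ (fun v => by simp [run, Function.update, hru.symm]) (by omega),
        ih _ (by simp [run, Function.update, hru.symm, hv])]
      funext i
      simp only [run, Function.update_apply]
      split_ifs <;> simp_all
      omega
  rw [copy, run, run, run, run_clear, run_clear, h1 _ _ rfl, h2 _ _ rfl]
  funext i
  simp only [Function.update_apply]
  split_ifs <;> simp_all

theorem wf_copy {z t r u : ℕ} (htr : t ≠ r) (hru : r ≠ u) (ht : t ≠ z) (hr : r ≠ z)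
    (hu : u ≠ z) : WF z (copy t r u) := by
  simp [copy, clear, WF, run, ht, hr, hu, Function.update, htr.symm, hru, hru.symm]

/-- The program `p` puts the value of `f` at the registers `a` into the register `o`, and it
preserves all other registers below `N`. -/
def Implements (z N : ℕ) (p : Loop) {n : ℕ} (f : List.Vector ℕ n → ℕ) (a : Fin n → ℕ)
    (o : ℕ) : Prop :=
  WF z p ∧ ∀ s, run p s o = f (List.Vector.ofFn fun i => s (a i)) ∧
    ∀ r < N, r ≠ o → run p s r = s r

/-- One program that evaluates finitely many functions into the registers `N, N + 1, …`. -/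
theorem exists_implements_family {z N m : ℕ} {n : ℕ} (g : Fin n → List.Vector ℕ m → ℕ)
    (a : Fin m → ℕ) (hz : z < N) (ha : ∀ i, a i < N)
    (hg : ∀ i (o M : ℕ), N ≤ M → o < M → o ≠ z → ∃ p, Implements z M p (g i) a o) :
    ∃ p, WF z p ∧ ∀ s, (∀ i : Fin n, run p s (N + i) = g i (List.Vector.ofFn fun j => s (a j))) ∧
      ∀ r < N, run p s r = s r := by
  induction n with
  | zero => exact ⟨skip, trivial, fun s => ⟨fun i => i.elim0, fun _ _ => rfl⟩⟩
  | succ n ih =>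
    obtain ⟨p, hp, hp'⟩ := ih (fun i => g i.castSucc) fun i => hg i.castSucc
    -- The bound `N + n + 1` lies above the outputs already stored, so `q` preserves them.
    obtain ⟨q, hq, hq'⟩ := hg (Fin.last n) (N + n) (N + n + 1) (by omega) (by omega) (by omega)
    refine ⟨seq p q, ⟨hp, hq⟩, fun s => ⟨fun i => ?_, fun r hr => ?_⟩⟩
    · rw [run]
      induction i using Fin.lastCases with
      | last =>
        rw [Fin.val_last, (hq' _).1]
        congr
        funext j
        exact (hp' s).2 _ (ha j)
      | cast i =>
        rw [(hq' _).2 _ (by simp only [Fin.val_castSucc]; omega)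
          (by simp only [Fin.val_castSucc]; omega)]
        exact (hp' s).1 i
    · rw [run, (hq' _).2 _ (by omega) (by omega), (hp' s).2 r hr]

/-- Induction on the construction of `f`. The registers from `N` on are scratch space, and
subprograms get larger bounds so that they do not disturb intermediate results. -/
theorem exists_implements {n : ℕ} {f : List.Vector ℕ n → ℕ} (hf : Nat.Primrec' f) {z : ℕ} :
    ∀ (a : Fin n → ℕ) (o N : ℕ), z < N → o < N → o ≠ z → (∀ i, a i < N ∧ a i ≠ z) →
      ∃ p, Implements z N p f a o := by
  induction hf with
  | zero =>
    intro a o N hz ho hoz ha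
    refine ⟨clear o, ⟨fun _ => rfl, trivial⟩, fun s => ⟨?_, fun r hr hro => ?_⟩⟩
    · rw [run_clear]; simp
    · rw [run_clear, Function.update_of_ne hro]
  | succ =>
    intro a o N hz ho hoz ha
    by_cases h : o = a 0
    · refine ⟨inc o, hoz, fun s => ⟨?_, fun r hr hro => ?_⟩⟩
      · simp [run, h]
      · rw [run, Function.update_of_ne hro]
    · have h1 := ha 0
      refine ⟨seq (copy o (a 0) N) (inc o),
        ⟨wf_copy h (by omega) hoz h1.2 (by omega), hoz⟩, fun s => ⟨?_, fun r hr hro => ?_⟩⟩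
      · rw [run, run_copy h (by omega) (by omega)]; simp [run]
      · rw [run, run, Function.update_of_ne hro, run_copy h (by omega) (by omega),
          Function.update_of_ne hro, Function.update_of_ne (by omega)]
  | get i =>
    intro a o N hz ho hoz ha
    by_cases h : o = a i
    · exact ⟨skip, trivial, fun s => ⟨by simp [run, h], fun _ _ _ => rfl⟩⟩
    · have h1 := ha i
      refine ⟨copy o (a i) N, wf_copy h (by omega) hoz h1.2 (by omega),
        fun s => ⟨?_, fun r hr hro => ?_⟩⟩
      · rw [run_copy h (by omega) (by omega)]; simp
      · rw [run_copy h (by omega) (by omega), Function.update_of_ne hro,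
          Function.update_of_ne (by omega)]
  | @comp m n f g _ _ ihf ihg =>
    intro a o N hz ho hoz ha
    obtain ⟨p, hp, hp'⟩ := exists_implements_family g a hz (fun i => (ha i).1)
      fun i o M hM hoM hoz => ihg i a o M (by omega) hoM hoz
        fun j => ⟨by have := (ha j).1; omega, (ha j).2⟩
    obtain ⟨q, hq, hq'⟩ := ihf (fun i => N + i) o (N + n) (by omega) (by omega) hoz
      fun i => ⟨by omega, by omega⟩
    refine ⟨seq p q, ⟨hp, hq⟩, fun s => ⟨?_, fun r hr hro => ?_⟩⟩
    · rw [run, (hq' _).1]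
      congr
      funext i
      exact (hp' s).1 i
    · rw [run, (hq' _).2 _ (by omega) hro, (hp' s).2 r hr]
  | @prec n f g _ _ ihf ihg =>
    intro a o N hz ho hoz ha
    have ha' : ∀ i, a i < N := fun i => (ha i).1
    -- In the loop, `N` counts the remaining passes, `N + 1` is the recursion index, `N + 2` holds
    -- the current value and `N + 3` the next one; `N + 4` is scratch for copying.
    obtain ⟨p, hp, hp'⟩ := ihf (fun i => a i.succ) (N + 2) (N + 4) (by omega) (by omega)
      (by omega) fun i => ⟨by have := ha' i.succ; omega, (ha i.succ).2⟩
    obtain ⟨q, hq, hq'⟩ := ihg (Fin.cons (N + 1) (Fin.cons (N + 2) fun i => a i.succ)) (N + 3)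
      (N + 4) (by omega) (by omega) (by omega) (by
        intro i
        refine Fin.cases ?_ (fun i => ?_) i
        · simp only [Fin.cons_zero]; omega
        · refine Fin.cases ?_ (fun i => ?_) i
          · simp only [Fin.cons_succ, Fin.cons_zero]; omega
          · simp only [Fin.cons_succ]; exact ⟨by have := ha' i.succ; omega, (ha i.succ).2⟩)
    set body := seq q (seq (copy (N + 2) (N + 3) (N + 4)) (inc (N + 1))) with hbody
    have run_body : ∀ s, run body s = Function.update (Function.update (Function.update
        (run q s) (N + 4) 0) (N + 2) (run q s (N + 3))) (N + 1) (run q s (N + 1) + 1) := by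
      intro s
      rw [hbody, run, run, run_copy (by omega) (by omega) (by omega), run]
      congr 1
      simp [Function.update_of_ne]
    have body_low : ∀ s r, r ≤ N → run body s r = s r := by
      intro s r hr
      rw [run_body, Function.update_of_ne (by omega), Function.update_of_ne (by omega),
        Function.update_of_ne (by omega), (hq' s).2 r (by omega) (by omega)]
    -- The invariant is that `N + 2` holds the recursion at the index in `N + 1`. The starting index
    -- is arbitrary, so that the induction can run on the number of remaining passes.
    have key : ∀ (k : ℕ) (v : List.Vector ℕ n) (s : ℕ → ℕ), s N = k →
        (List.Vector.ofFn fun i : Fin n => s (a i.succ)) = v →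
        s (N + 2) = Nat.rec (f v) (fun y IH => g (y ::ᵥ IH ::ᵥ v)) (s (N + 1)) →
        run (loop N body) s (N + 2) =
          Nat.rec (f v) (fun y IH => g (y ::ᵥ IH ::ᵥ v)) (s (N + 1) + k) ∧
        ∀ r < N, run (loop N body) s r = s r := by
      intro k
      induction k with
      | zero =>
        intro v s hs hv h
        rw [run_loop_zero hs]
        exact ⟨h, fun _ _ => rfl⟩
      | succ k ih =>
        intro v s hs hv h
        rw [run_loop_succ (fun s => body_low s N le_rfl) (by omega)]
        set s' := Function.update s N (s N - 1) with hs'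
        have e : ∀ r, r ≠ N → s' r = s r := fun r hr => by rw [hs', Function.update_of_ne hr]
        have hlow : ∀ r < N, run body s' r = s r := fun r hr => by
          rw [body_low s' r (by omega), e r (by omega)]
        have h1 : run body s' (N + 1) = s (N + 1) + 1 := by
          rw [run_body, Function.update_self, (hq' s').2 _ (by omega) (by omega), e _ (by omega)]
        obtain ⟨h2, h3⟩ := ih v (run body s') (by rw [body_low s' N le_rfl, hs']; simp [hs])
          (by
            rw [← hv]; congr; funext i
            exact hlow _ (ha' _))
          (by
            rw [h1, run_body, Function.update_of_ne (by omega), Function.update_self, (hq' s').1]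
            simp only [List.Vector.ofFn, Fin.cons_zero, Fin.cons_succ]
            rw [e (N + 1) (by omega), e (N + 2) (by omega), h, ← hv]
            congr 3
            simp only [e _ (ha' _).ne])
        refine ⟨?_, fun r hr => ?_⟩
        · rw [h2, h1, show s (N + 1) + 1 + k = s (N + 1) + (k + 1) by omega]
        · rw [h3 r hr, hlow r hr]
    have h0 := ha 0
    refine ⟨seq (copy N (a 0) (N + 1)) (seq (clear (N + 1)) (seq p
      (seq (loop N body) (copy o (N + 2) N)))), ⟨wf_copy (by omega) (by omega) (by omega) h0.2
      (by omega), ⟨fun _ => rfl, trivial⟩, hp, ⟨fun s => body_low s N le_rfl, hq,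
        wf_copy (by omega) (by omega) (by omega) (by omega) (by omega), by simp only [WF]; omega⟩,
      wf_copy (by omega) (by omega) (by omega) (by omega) (by omega)⟩, fun s => ?_⟩
    simp only [run]
    rw [run_copy (by omega) (by omega) (by omega), run_copy (by omega) (by omega) (by omega),
      run_clear]
    set s1 := Function.update (Function.update (Function.update s (N + 1) 0) N (s (a 0)))
      (N + 1) 0 with hs1
    have e1 : ∀ r < N, s1 r = s r := fun r hr => by
      rw [hs1, Function.update_of_ne (by omega), Function.update_of_ne (by omega),
        Function.update_of_ne (by omega)]
    have e2 : ∀ r, r ≠ N + 2 → r < N + 4 → run p s1 r = s1 r := fun r hr hr' => (hp' s1).2 r hr' hr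
    have hN : run p s1 N = s (a 0) := by
      rw [e2 _ (by omega) (by omega), hs1, Function.update_of_ne (by omega), Function.update_self]
    have hN1 : run p s1 (N + 1) = 0 := by
      rw [e2 _ (by omega) (by omega), hs1, Function.update_self]
    obtain ⟨h2, h3⟩ := key (s (a 0)) (List.Vector.ofFn fun i : Fin n => s (a i.succ)) (run p s1) hN
      (by
        congr; funext i
        rw [e2 _ (by have := ha' i.succ; omega) (by have := ha' i.succ; omega), e1 _ (ha' _)])
      (by
        rw [hN1, (hp' s1).1]
        simp only [e1 _ (ha' _)]
        rfl)
    simp only [run] at h2 h3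
    refine ⟨?_, fun r hr hro => ?_⟩
    · rw [Function.update_self, h2, hN1, zero_add]
      simp [List.Vector.ofFn]
    · rw [Function.update_of_ne hro, Function.update_of_ne (by omega), h3 r hr,
        e2 _ (by omega) (by omega), e1 r hr]

end Loop

/-! ### A machine that performs an unbounded search. -/

/-- From the state `(1, input v)` the program reaches its end if and only if `g v t = 0` for some
`t`; the address `0` is reserved for reading the input. -/
theorem exists_program {g : ℕ → ℕ → ℕ} (hg : Primrec₂ g) :
    ∃ P : List Instr, P[0]? = some (.inc 0) ∧ 1 < P.length ∧
      (∀ r j, Instr.dec r j ∈ P → j ≠ 0 ∧ j ≤ P.length) ∧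
      ∀ v, (∃ t, ((step P)^[t] (1, Function.update (fun _ => 0) 0 v)).1 = P.length) ↔
        ∃ t, g v t = 0 := by
  obtain ⟨p, hp, hp'⟩ := Loop.exists_implements (Nat.Primrec'.prim_iff₂.2 hg) (z := 1)
    ![0, 2] 3 4 (by omega) (by omega) (by omega) (by
      intro i; fin_cases i <;> simp)
  set k := Loop.size p with hk
  -- Register `0` holds `v`, `1` stays zero, `2` is the candidate `t`, and `3` receives `g v t`.
  -- After `p` the machine exits if register `3` is zero; otherwise it increments `t` and returns to
  -- the address `1`.
  set P : List Instr := [.inc 0] ++ (Loop.compile 1 p 1 ++ [.dec 3 (k + 4), .inc 2, .dec 1 1]) with hP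
  have hlen : P.length = k + 4 := by
    simp only [hP, List.length_append, List.length_cons, List.length_nil, Loop.length_compile]
    omega
  have hself : Loop.Occurs P P 0 := fun i c h => by simpa using h
  have hcode : Loop.Occurs (Loop.compile 1 p 1) P 1 := hself.right.left
  have hend := hself.right.right
  rw [Loop.length_compile, ← hk] at hend
  have e0 : P[1 + k]? = some (.dec 3 (k + 4)) := by simpa using hend 0 _ rfl
  have e1 : P[1 + k + 1]? = some (.inc 2) := by simpa using hend 1 _ rfl
  have e2 : P[1 + k + 2]? = some (.dec 1 1) := by simpa using hend 2 _ rfl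
  have hhalt : P[k + 4]? = none := by rw [List.getElem?_eq_none_iff]; omega
  refine ⟨P, rfl, by omega, ?_, fun v => ?_⟩
  · intro r j h
    simp only [hP, List.mem_append, List.mem_cons, List.not_mem_nil, or_false, reduceCtorEq,
      false_or, Instr.dec.injEq] at h
    rcases h with h | h | h
    · have := Loop.jump_of_mem_compile h; omega
    · omega
    · omega
  · rw [hlen]
    have round : ∀ s : ℕ → ℕ, s 0 = v → s 1 = 0 → ∃ T, (step P)^[T] (1, s) = (1 + k, Loop.run p s) ∧
        Loop.run p s 3 = g v (s 2) ∧ Loop.run p s 0 = v ∧ Loop.run p s 1 = 0 ∧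
        Loop.run p s 2 = s 2 := by
      intro s h0 h1
      obtain ⟨T, hT⟩ := Loop.exists_iterate_step hp hcode h1
      refine ⟨T, hT, ?_, ?_, ?_, ?_⟩
      · rw [(hp' s).1]; simp [List.Vector.ofFn, h0]
      · rw [(hp' s).2 0 (by omega) (by omega), h0]
      · rw [(hp' s).2 1 (by omega) (by omega), h1]
      · rw [(hp' s).2 2 (by omega) (by omega)]
    have next : ∀ s : ℕ → ℕ, s 0 = v → s 1 = 0 → g v (s 2) ≠ 0 → ∃ T s',
        (step P)^[T + 1] (1, s) = (1, s') ∧ s' 0 = v ∧ s' 1 = 0 ∧ s' 2 = s 2 + 1 := by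
      intro s h0 h1 h
      obtain ⟨T, hT, h3, h0', h1', h2'⟩ := round s h0 h1
      set s' := Function.update (Loop.run p s) 3 (Loop.run p s 3 - 1)
      refine ⟨2 + T, Function.update s' 2 (s' 2 + 1), ?_, ?_⟩
      · rw [show 2 + T + 1 = 1 + (1 + (1 + T)) by omega, Function.iterate_add_apply,
          Function.iterate_add_apply _ 1 (1 + T), Function.iterate_add_apply _ 1 T, hT,
          Function.iterate_one, step_dec_pos e0 (by rwa [h3]), step_inc e1,
          step_dec_zero e2 (by simp [Function.update, h1'])]
      · simp [s', Function.update, h0', h1', h2']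
    constructor
    · rintro ⟨T, hT⟩
      by_contra! hne
      -- Without a zero of `g v` the machine is at the address `1` at arbitrarily late times,
      -- whereas a halted machine stays at its end.
      have many : ∀ i, ∃ T s', i ≤ T ∧ (step P)^[T] (1, Function.update (fun _ => 0) 0 v) = (1, s') ∧
          s' 0 = v ∧ s' 1 = 0 := by
        intro i
        induction i with
        | zero => exact ⟨0, _, le_rfl, rfl, by simp, by simp⟩
        | succ i ih =>
          obtain ⟨T, s', hi, hs, h0, h1⟩ := ih
          obtain ⟨T', s'', hs', h0', h1', -⟩ := next s' h0 h1 (hne _)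
          refine ⟨T' + 1 + T, s'', by omega, ?_, h0', h1'⟩
          rw [Function.iterate_add_apply, hs, hs']
      obtain ⟨T', s', hT', hs, -, -⟩ := many T
      obtain ⟨d, rfl⟩ := Nat.exists_eq_add_of_le' hT'
      have stay : ∀ d (c : ℕ × (ℕ → ℕ)), c.1 = k + 4 → (step P)^[d] c = c := by
        intro d c hc
        exact Function.iterate_fixed (by simp [step, hc, hhalt]) d
      rw [Function.iterate_add_apply, stay _ _ hT] at hs
      rw [hs] at hT
      omega
    · rintro ⟨t, ht⟩
      have many : ∀ i, (∃ T, ((step P)^[T] (1, Function.update (fun _ => 0) 0 v)).1 = k + 4) ∨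
          ∃ T s', (step P)^[T] (1, Function.update (fun _ => 0) 0 v) = (1, s') ∧
            s' 0 = v ∧ s' 1 = 0 ∧ s' 2 = i := by
        intro i
        induction i with
        | zero => exact Or.inr ⟨0, _, rfl, by simp, by simp, by simp⟩
        | succ i ih =>
          rcases ih with ih | ⟨T, s', hs, h0, h1, h2⟩
          · exact Or.inl ih
          · by_cases h : g v (s' 2) = 0
            · left
              obtain ⟨T', hT', h3, -⟩ := round s' h0 h1
              refine ⟨1 + (T' + T), ?_⟩
              rw [Function.iterate_add_apply, Function.iterate_add_apply _ T', hs, hT',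
                Function.iterate_one, step_dec_zero e0 (by rw [h3, h])]
            · right
              obtain ⟨T', s'', hs', h0', h1', h2'⟩ := next s' h0 h1 h
              refine ⟨T' + 1 + T, s'', ?_, h0', h1', by omega⟩
              rw [Function.iterate_add_apply, hs, hs']
      rcases many t with h | ⟨T, s', hs, h0, h1, h2⟩
      · exact h
      · obtain ⟨T', hT', h3, -⟩ := round s' h0 h1
        refine ⟨1 + (T' + T), ?_⟩
        rw [Function.iterate_add_apply, Function.iterate_add_apply _ T', hs, hT',
          Function.iterate_one, step_dec_zero e0 (by rw [h3, h2, ht])]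

/-! ### Semantics over endpoints, and derived connectives. -/

namespace Formula

/-- Satisfaction over the points `0, …, k`, with intervals given by their endpoints. -/
def Holds (k : ℕ) (v : ℕ → ℕ → Set ℕ) : ℕ → ℕ → Formula → Prop
  | x, y, letter a => a ∈ v x y
  | x, y, neg ψ => ¬ Holds k v x y ψ
  | x, y, or ψ χ => Holds k v x y ψ ∨ Holds k v x y χ
  | _, y, diaA ψ => ∃ z, y ≤ z ∧ z ≤ k ∧ Holds k v y z ψ
  | x, _, diaAbar ψ => ∃ z ≤ x, Holds k v z x ψ
  | x, y, diaB ψ => ∃ z, x ≤ z ∧ z < y ∧ Holds k v x z ψ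
  | x, y, diaBbar ψ => ∃ z, y < z ∧ z ≤ k ∧ Holds k v x z ψ

theorem self_mem_subformulas (φ : Formula) : φ ∈ φ.subformulas := by
  cases φ <;> simp [subformulas]

/-- Agreement is needed only on the letters of `φ`: the labels to which this is applied may contain
letters outside the alphabet of the game. -/
theorem sat_iff_holds {k : ℕ} {V : NonemptyInterval (Fin (k + 1)) → Set ℕ} {v : ℕ → ℕ → Set ℕ}
    {φ : Formula} (hV : ∀ a, letter a ∈ φ.subformulas → ∀ I, a ∈ V I ↔ a ∈ v I.fst I.snd)
    (I : NonemptyInterval (Fin (k + 1))) : Sat V I φ ↔ Holds k v I.fst I.snd φ := by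
  induction φ generalizing I with
  | letter a => exact hV a (self_mem_subformulas _) I
  | neg ψ ih => exact not_congr (ih (fun a ha => hV a (Or.inr ha)) I)
  | or ψ χ ih1 ih2 =>
    exact or_congr (ih1 (fun a ha => hV a (Or.inl (Or.inr ha))) I)
      (ih2 (fun a ha => hV a (Or.inr ha)) I)
  | diaA ψ ih =>
    have ih := ih fun a ha => hV a (Or.inr ha)
    constructor
    · rintro ⟨J, h, hJ⟩
      refine ⟨J.snd, ?_, by omega, ?_⟩
      · rw [h]; exact J.fst_le_snd
      · rw [h]; exact (ih J).1 hJ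
    · rintro ⟨z, h1, h2, h⟩
      exact ⟨⟨(I.snd, ⟨z, by omega⟩), h1⟩, rfl, (ih _).2 h⟩
  | diaAbar ψ ih =>
    have ih := ih fun a ha => hV a (Or.inr ha)
    constructor
    · rintro ⟨J, h, hJ⟩
      refine ⟨J.fst, ?_, ?_⟩
      · rw [h]; exact J.fst_le_snd
      · rw [h]; exact (ih J).1 hJ
    · rintro ⟨z, h1, h⟩
      exact ⟨⟨(⟨z, by omega⟩, I.fst), h1⟩, rfl, (ih _).2 h⟩
  | diaB ψ ih =>
    have ih := ih fun a ha => hV a (Or.inr ha)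
    constructor
    · rintro ⟨J, ⟨h, h'⟩, hJ⟩
      refine ⟨J.snd, ?_, h', ?_⟩
      · rw [h]; exact J.fst_le_snd
      · rw [h]; exact (ih J).1 hJ
    · rintro ⟨z, h1, h2, h⟩
      exact ⟨⟨(I.fst, ⟨z, by omega⟩), h1⟩, ⟨rfl, h2⟩, (ih _).2 h⟩
  | diaBbar ψ ih =>
    have ih := ih fun a ha => hV a (Or.inr ha)
    constructor
    · rintro ⟨J, ⟨h, h'⟩, hJ⟩
      refine ⟨J.snd, h', by omega, ?_⟩
      · rw [h]; exact (ih J).1 hJ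
    · rintro ⟨z, h1, h2, h⟩
      have := I.fst_le_snd
      exact ⟨⟨(I.fst, ⟨z, by omega⟩), by rw [Fin.le_def] at *; simp only; omega⟩, ⟨rfl, h1⟩,
        (ih _).2 h⟩

/-- Conjunction. -/
def and (φ ψ : Formula) : Formula := neg (or (neg φ) (neg ψ))

/-- Implication. -/
def imp (φ ψ : Formula) : Formula := or (neg φ) ψ

/-- A tautology. -/
def top : Formula := or (letter 1) (neg (letter 1))

/-- The conjunction of a list of formulas. -/
def conj : List Formula → Formula
  | [] => top
  | φ :: l => and φ (conj l)

/-- The disjunction of a list of formulas. -/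
def disj : List Formula → Formula
  | [] => neg top
  | φ :: l => or φ (disj l)

section
variable {k : ℕ} {v : ℕ → ℕ → Set ℕ} {x y : ℕ}

@[simp] theorem holds_letter {a : ℕ} : Holds k v x y (letter a) ↔ a ∈ v x y := Iff.rfl

@[simp] theorem holds_neg {φ : Formula} : Holds k v x y (neg φ) ↔ ¬ Holds k v x y φ := Iff.rfl

@[simp] theorem holds_or {φ ψ : Formula} :
    Holds k v x y (or φ ψ) ↔ Holds k v x y φ ∨ Holds k v x y ψ := Iff.rfl

@[simp] theorem holds_diaA {φ : Formula} :
    Holds k v x y (diaA φ) ↔ ∃ z, y ≤ z ∧ z ≤ k ∧ Holds k v y z φ := Iff.rfl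

@[simp] theorem holds_diaAbar {φ : Formula} :
    Holds k v x y (diaAbar φ) ↔ ∃ z ≤ x, Holds k v z x φ := Iff.rfl

@[simp] theorem holds_diaB {φ : Formula} :
    Holds k v x y (diaB φ) ↔ ∃ z, x ≤ z ∧ z < y ∧ Holds k v x z φ := Iff.rfl

@[simp] theorem holds_diaBbar {φ : Formula} :
    Holds k v x y (diaBbar φ) ↔ ∃ z, y < z ∧ z ≤ k ∧ Holds k v x z φ := Iff.rfl

@[simp] theorem holds_and {φ ψ : Formula} :
    Holds k v x y (and φ ψ) ↔ Holds k v x y φ ∧ Holds k v x y ψ := by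
  simp only [and, holds_neg, holds_or]; tauto

@[simp] theorem holds_imp {φ ψ : Formula} :
    Holds k v x y (imp φ ψ) ↔ (Holds k v x y φ → Holds k v x y ψ) := by
  simp only [imp, holds_neg, holds_or]; tauto

@[simp] theorem holds_top : Holds k v x y top := em _

@[simp] theorem holds_conj {l : List Formula} :
    Holds k v x y (conj l) ↔ ∀ φ ∈ l, Holds k v x y φ := by
  induction l with
  | nil => simp [conj]
  | cons φ l ih => simp [conj, ih]

@[simp] theorem holds_disj {l : List Formula} :
    Holds k v x y (disj l) ↔ ∃ φ ∈ l, Holds k v x y φ := by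
  induction l with
  | nil => simp [disj]
  | cons φ l ih => simp [disj, ih]

theorem holds_iterate_diaB {j : ℕ} (hxy : x ≤ y) :
    Holds k v x y (diaB^[j] top) ↔ x + j ≤ y := by
  induction j generalizing y with
  | zero => simpa using hxy
  | succ j ih =>
    rw [Function.iterate_succ_apply', holds_diaB]
    constructor
    · rintro ⟨z, h1, h2, h⟩
      rw [ih h1] at h
      omega
    · intro h
      exact ⟨x + j, by omega, by omega, (ih (by omega)).2 le_rfl⟩

end

/-- The intervals `[x, x + 1]`. -/
def unit : Formula := and (diaB top) (neg (diaB (diaB top)))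

theorem holds_unit {k : ℕ} {v : ℕ → ℕ → Set ℕ} {x y : ℕ} : Holds k v x y unit ↔ y = x + 1 := by
  simp only [unit, holds_and, holds_neg, holds_diaB, holds_top, and_true]
  constructor
  · rintro ⟨⟨z, h1, h2⟩, h⟩
    by_contra hne
    exact h ⟨x + 1, by omega, by omega, x, by omega, by omega⟩
  · rintro rfl
    refine ⟨⟨x, by omega, by omega⟩, ?_⟩
    rintro ⟨z, h1, h2, z', h3, h4⟩
    omega

/-! ### The specification of a halting run. -/

/-- The letter of Spoiler. -/
abbrev mark : Formula := letter 0

/-- The interval `[x, y]` carries this letter if the thread `x` is consumed at the time `y`. -/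
abbrev kill : Formula := letter 1

/-- The point `y` carries the letter `at l` if the machine is at the address `l` at the time `y`. -/
abbrev addr (l : ℕ) : Formula := letter (l + 2)

/-- The current instruction increments the counter `r`. -/
def incs (P : List Instr) (r : ℕ) : Formula :=
  disj (((List.range P.length).filter fun l => P[l]? = some (.inc r)).map addr)

/-- What the instruction at the address `l` demands of an interval `[y, y + 1]`. -/
def rule (P : List Instr) (l : ℕ) : Formula :=
  match P[l]? with
  | none => top
  | some (.inc _) => diaA (addr (l + 1))
  | some (.dec r j) =>
    or (and (diaAbar kill) (diaA (addr (l + 1))))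
      (and (neg (diaAbar kill))
        (and (neg (diaAbar (and (diaAbar (incs P r)) (neg (diaB kill))))) (diaA (addr j))))

/-- A thread is only consumed by a decrement of its counter. -/
def killer (P : List Instr) (l : ℕ) : Formula :=
  match P[l]? with
  | some (.dec r _) => and (diaAbar (incs P r)) (diaA (addr l))
  | _ => neg top

/-- Duplicator's labels describe a run of the machine `P`, except that several threads may be
consumed at the same time. -/
def lawful (P : List Instr) : Formula :=
  and (conj ((List.range (P.length + 1)).map fun l => imp (addr l) (neg (diaB top))))
  (and (conj ((List.range (P.length + 1)).flatMap fun l => (List.range (P.length + 1)).map fun l' =>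
    if l = l' then top else neg (and (addr l) (addr l'))))
  (and (imp kill (neg (diaB kill)))
  (and (imp kill (disj ((List.range P.length).map (killer P))))
    (imp unit (conj ((List.range P.length).map fun l =>
      if l = 0 then top else imp (diaAbar (addr l)) (rule P l)))))))

/-- The interval `[x, y]` such that `[x, y - 1]` satisfies `kill` and `ψ`, provided that the thread
`x` is consumed at most once. -/
def killedWith (ψ : Formula) : Formula := and (neg (diaB (diaB kill))) (diaB (and kill ψ))

/-- No two threads have just been consumed such that one was marked and the other was not. -/
def unmixed : Formula :=
  neg (and (diaAbar (killedWith mark)) (diaAbar (killedWith (neg mark))))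

/-- Some interval that starts at the end of the current one is not lawful. -/
def fault (P : List Instr) : Formula := diaA (neg (and (lawful P) unmixed))

/-- The machine is at the address `0` at the times `0, …, n`, and at the address `1` at the time
`n + 1`. -/
def input (n : ℕ) : Formula :=
  diaBbar (and (diaB^[n + 1] top) (and (neg (diaB^[n + 2] top))
    (and (diaA (addr 1)) (neg (diaB (neg (diaA (addr 0))))))))

/-- The specification that expresses that the machine `P` halts on `n + 1`. -/
def spec (P : List Instr) (n : ℕ) : Formula :=
  and (input n) (and (neg (fault P)) (and (neg (diaBbar (fault P)))
    (diaBbar (diaA (addr P.length)))))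

section
variable {k : ℕ} {v : ℕ → ℕ → Set ℕ} {x y : ℕ}

theorem holds_incs {P : List Instr} {r : ℕ} :
    Holds k v x y (incs P r) ↔ ∃ l, P[l]? = some (.inc r) ∧ l + 2 ∈ v x y := by
  simp only [incs, holds_disj, List.mem_map, List.mem_filter, List.mem_range, decide_eq_true_eq]
  constructor
  · rintro ⟨_, ⟨l, ⟨_, h⟩, rfl⟩, h'⟩
    exact ⟨l, h, h'⟩
  · rintro ⟨l, h, h'⟩
    exact ⟨_, ⟨l, ⟨(List.getElem?_eq_some_iff.1 h).1, h⟩, rfl⟩, h'⟩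

theorem holds_killer {P : List Instr} {l : ℕ} :
    Holds k v x y (killer P l) ↔ ∃ r j, P[l]? = some (.dec r j) ∧
      Holds k v x y (diaAbar (incs P r)) ∧ Holds k v x y (diaA (addr l)) := by
  rw [killer]
  rcases h : P[l]? with _ | (r | ⟨r, j⟩) <;> simp

/-- The address `0` is exempt from the last clause because the input phase stays there for a time
prescribed by `input`. The `rule` of a decrement need not ask whose thread is consumed: the fourth
clause ties each `kill` to the counter of the current instruction. No clause bounds the number of
threads consumed at once. -/
theorem holds_lawful {P : List Instr} : Holds k v x y (lawful P) ↔
    (∀ l ≤ P.length, l + 2 ∈ v x y → y ≤ x) ∧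
    (∀ l ≤ P.length, ∀ l' ≤ P.length, l + 2 ∈ v x y → l' + 2 ∈ v x y → l = l') ∧
    (1 ∈ v x y → ∀ z, x ≤ z → z < y → 1 ∉ v x z) ∧
    (1 ∈ v x y → ∃ l r j, P[l]? = some (.dec r j) ∧
      Holds k v x y (diaAbar (incs P r)) ∧ Holds k v x y (diaA (addr l))) ∧
    (y = x + 1 → ∀ l < P.length, l ≠ 0 → (∃ z ≤ x, l + 2 ∈ v z x) → Holds k v x y (rule P l)) := by
  simp only [lawful, holds_and, holds_conj, holds_imp, holds_unit, holds_disj, List.mem_map,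
    List.mem_flatMap, List.mem_range, Nat.lt_succ_iff]
  refine and_congr ?_ (and_congr ?_ (and_congr ?_ (and_congr ?_ ?_)))
  · constructor
    · intro h l hl hv
      by_contra hlt
      exact holds_imp.1 (h _ ⟨l, hl, rfl⟩) hv ⟨x, le_rfl, by omega, holds_top⟩
    · rintro h _ ⟨l, hl, rfl⟩
      refine holds_imp.2 ?_
      rintro hv ⟨z, h1, h2, -⟩
      have := h l hl hv
      omega
  · constructor
    · intro h l hl l' hl' hv hv'
      by_contra hne
      have := h _ ⟨l, hl, l', hl', rfl⟩
      rw [if_neg hne, holds_neg, holds_and] at this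
      exact this ⟨hv, hv'⟩
    · rintro h _ ⟨l, hl, l', hl', rfl⟩
      split_ifs with hne
      · exact holds_top
      · rw [holds_neg, holds_and]
        exact fun hv => hne (h l hl l' hl' hv.1 hv.2)
  · simp
  · refine imp_congr_right fun _ => ⟨?_, ?_⟩
    · rintro ⟨_, ⟨l, hl, rfl⟩, h⟩
      exact ⟨l, holds_killer.1 h⟩
    · rintro ⟨l, r, j, hl, h⟩
      exact ⟨_, ⟨l, (List.getElem?_eq_some_iff.1 hl).1, rfl⟩, holds_killer.2 ⟨r, j, hl, h⟩⟩
  · refine imp_congr_right fun _ => ⟨?_, ?_⟩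
    · intro h l hl h0 hz
      have := h _ ⟨l, hl, rfl⟩
      rw [if_neg h0, holds_imp] at this
      exact this hz
    · rintro h _ ⟨l, hl, rfl⟩
      split_ifs with h0
      · exact holds_top
      · rw [holds_imp]
        exact h l hl h0

/-- The iterates of `diaB` measure length, so the initial interval chosen by `diaBbar` is exactly
`[0, n + 1]`. -/
theorem holds_input {n : ℕ} : Holds k v 0 0 (input n) ↔
    n + 1 ≤ k ∧ (∃ z, n + 1 ≤ z ∧ z ≤ k ∧ 3 ∈ v (n + 1) z) ∧
      ∀ y ≤ n, ∃ z, y ≤ z ∧ z ≤ k ∧ 2 ∈ v y z := by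
  simp only [input, holds_diaBbar, holds_and, holds_neg]
  constructor
  · rintro ⟨y, -, hyk, h1, h2, h3, h4⟩
    rw [holds_iterate_diaB (by omega)] at h1 h2
    obtain rfl : y = n + 1 := by omega
    refine ⟨hyk, h3, fun y hy => ?_⟩
    by_contra hc
    exact h4 ⟨y, by omega, by omega, hc⟩
  · rintro ⟨h1, h2, h3⟩
    refine ⟨n + 1, by omega, h1, ?_, ?_, h2, ?_⟩
    · rw [holds_iterate_diaB (by omega)]; omega
    · rw [holds_iterate_diaB (by omega)]; omega
    · rintro ⟨y, -, hy, h⟩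
      exact h (h3 y (by omega))

/-- On `[0, x]`, `fault` inspects all intervals that start at `x`. The case `x = 0` needs its own
conjunct, as `diaBbar` only reaches proper extensions of `[0, 0]`. -/
theorem holds_spec {P : List Instr} {n : ℕ} : Holds k v 0 0 (spec P n) ↔
    Holds k v 0 0 (input n) ∧
    (∀ x y, x ≤ y → y ≤ k → Holds k v x y (lawful P) ∧ Holds k v x y unmixed) ∧
    ∃ y, 0 < y ∧ y ≤ k ∧ ∃ z, y ≤ z ∧ z ≤ k ∧ P.length + 2 ∈ v y z := by
  simp only [spec, fault, holds_and, holds_neg, holds_diaA, holds_diaBbar]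
  refine and_congr Iff.rfl ?_
  constructor
  · rintro ⟨h1, h2, h3⟩
    refine ⟨fun x y hxy hy => ?_, h3⟩
    by_contra hc
    rcases Nat.eq_zero_or_pos x with rfl | hx
    · exact h1 ⟨y, hxy, hy, hc⟩
    · exact h2 ⟨x, hx, by omega, y, hxy, hy, hc⟩
  · rintro ⟨h1, h2⟩
    refine ⟨?_, ?_, h2⟩
    · rintro ⟨z, h, h', hc⟩
      exact hc (h1 _ _ h h')
    · rintro ⟨x, -, -, z, h, h', hc⟩
      exact hc (h1 _ _ h h')

end
-- From models of the specification to halting runs.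
open Classical in
/-- The threads that belong to the counter `r` at the time `y`. -/
noncomputable def threads (P : List Instr) (v : ℕ → ℕ → Set ℕ) (y r : ℕ) : Finset ℕ :=
  {x ∈ Finset.range y | (∃ l, P[l]? = some (.inc r) ∧ l + 2 ∈ v x x) ∧
    ∀ z, x ≤ z → z < y → 1 ∉ v x z}

theorem mem_threads {P : List Instr} {v : ℕ → ℕ → Set ℕ} {y r x : ℕ} : x ∈ threads P v y r ↔
    x < y ∧ (∃ l, P[l]? = some (.inc r) ∧ l + 2 ∈ v x x) ∧ ∀ z, x ≤ z → z < y → 1 ∉ v x z := by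
  simp [threads]

/-- If Spoiler marks the threads `x` for which some thread below `x` is consumed at the same
time, then a model of the specification contains a halting run. -/
theorem exists_halting_of_holds_spec {P : List Instr} {n k : ℕ} {v : ℕ → ℕ → Set ℕ}
    (hP0 : P[0]? = some (.inc 0)) (hP1 : 1 < P.length)
    (hjump : ∀ r j, Instr.dec r j ∈ P → j ≠ 0 ∧ j ≤ P.length) (h : Holds k v 0 0 (spec P n))
    (hmark : ∀ x y, x ≤ y → y ≤ k → (0 ∈ v x y ↔ ∃ x' < x, 1 ∈ v x' y)) :
    ∃ t, ((step P)^[t] (1, Function.update (fun _ => 0) 0 (n + 1))).1 = P.length := by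
  obtain ⟨hin, hlaw, hhalt⟩ := holds_spec.1 h
  obtain ⟨hnk, hin1, hin0⟩ := holds_input.1 hin
  have hpoint : ∀ x y l, x ≤ y → y ≤ k → l ≤ P.length → l + 2 ∈ v x y → x = y :=
    fun x y l hxy hy hl hv => le_antisymm hxy
      ((holds_lawful.1 (hlaw x y hxy hy).1).1 l hl hv)
  have hexcl : ∀ y l l', y ≤ k → l ≤ P.length → l' ≤ P.length → l + 2 ∈ v y y → l' + 2 ∈ v y y →
      l = l' := fun y l l' hy hl hl' h1 h2 =>
    (holds_lawful.1 (hlaw y y le_rfl hy).1).2.1 l hl l' hl' h1 h2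
  have honce : ∀ x y z, x ≤ z → z < y → y ≤ k → 1 ∈ v x y → 1 ∉ v x z := fun x y z hxz hzy hy hv =>
    (holds_lawful.1 (hlaw x y (by omega) hy).1).2.2.1 hv z hxz hzy
  have hlt : ∀ {l c}, P[l]? = some c → l < P.length := fun hc => (List.getElem?_eq_some_iff.1 hc).1
  -- Addresses sit on points only, so a request for an address speaks about the endpoint itself.
  have hdiaA : ∀ {x y l}, y ≤ k → l ≤ P.length → Holds k v x y (diaA (addr l)) → l + 2 ∈ v y y := by
    rintro x y l hy hl ⟨z, h1, h2, hz⟩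
    obtain rfl := hpoint _ _ _ h1 h2 hl hz
    exact hz
  have hincs : ∀ {x y r}, x ≤ k → Holds k v x y (diaAbar (incs P r)) →
      ∃ l, P[l]? = some (.inc r) ∧ l + 2 ∈ v x x := by
    rintro x y r hx ⟨z, h1, hz⟩
    obtain ⟨l, hl, hz⟩ := holds_incs.1 hz
    obtain rfl := hpoint _ _ _ h1 hx (hlt hl).le hz
    exact ⟨l, hl, hz⟩
  have hkill : ∀ x y, x ≤ y → y ≤ k → 1 ∈ v x y → ∃ l r j, P[l]? = some (.dec r j) ∧
      l + 2 ∈ v y y ∧ ∃ l', P[l']? = some (.inc r) ∧ l' + 2 ∈ v x x := by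
    intro x y hxy hy hv
    obtain ⟨l, r, j, hl, h1, h2⟩ := (holds_lawful.1 (hlaw x y hxy hy).1).2.2.2.1 hv
    exact ⟨l, r, j, hl, hdiaA hy (hlt hl).le h2, hincs (by omega) h1⟩
  have hrule : ∀ y l, y < k → l < P.length → l ≠ 0 → l + 2 ∈ v y y →
      Holds k v y (y + 1) (rule P l) := fun y l hy hl h0 hv =>
    (holds_lawful.1 (hlaw y (y + 1) (by omega) hy).1).2.2.2.2 rfl l hl h0 ⟨y, le_rfl, hv⟩
  -- The leftmost thread consumed at `y` is unmarked while `x'` is marked, which violates `unmixed`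
  -- on `[y + 1, y + 1]`. That point must exist, hence `y < k`; what is consumed at the last time is
  -- irrelevant.
  have hsingle' : ∀ y x x', y < k → x < x' → x' ≤ y → 1 ∈ v x y → 1 ∉ v x' y := by
    classical
    intro y x x' hy hxx hx'y hv hv'
    have hex : ∃ x, 1 ∈ v x y := ⟨x, hv⟩
    have hle : Nat.find hex ≤ x := Nat.find_min' hex hv
    have hkw : ∀ z ψ, z ≤ y → 1 ∈ v z y → Holds k v z y ψ →
        Holds k v z (y + 1) (killedWith ψ) := by
      intro z ψ hz hv hψ
      refine holds_and.2 ⟨?_, y, hz, by omega, holds_and.2 ⟨hv, hψ⟩⟩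
      rintro ⟨z1, h1, h2, z2, h3, h4, h5⟩
      exact honce z y z2 h3 (by omega) hy.le hv h5
    refine (hlaw (y + 1) (y + 1) le_rfl hy).2 (holds_and.2 ⟨?_, ?_⟩)
    · exact ⟨x', by omega, hkw x' mark hx'y hv'
        ((hmark x' y hx'y hy.le).2 ⟨x, hxx, hv⟩)⟩
    · refine ⟨Nat.find hex, by omega, hkw _ (neg mark) (by omega) (Nat.find_spec hex) fun hm => ?_⟩
      obtain ⟨x0, hx0, hv0⟩ := (hmark _ y (by omega) hy.le).1 hm
      exact Nat.find_min hex hx0 hv0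
  have hsingle : ∀ y x x', y < k → x ≤ y → x' ≤ y → 1 ∈ v x y → 1 ∈ v x' y → x = x' := by
    intro y x x' hy hx hx' hv hv'
    rcases lt_trichotomy x x' with hlt | heq | hlt
    · exact absurd hv' (hsingle' y x x' hy hlt hx' hv)
    · exact heq
    · exact absurd hv (hsingle' y x' x hy hlt hx hv')
  -- at a time of an increment no thread is consumed
  have hinc : ∀ y l r, y ≤ k → P[l]? = some (.inc r) → l + 2 ∈ v y y →
      ∀ r', threads P v (y + 1) r' = if r' = r then insert y (threads P v y r')
        else threads P v y r' := by
    intro y l r hy hl hv r'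
    have hno : ∀ x ≤ y, 1 ∉ v x y := by
      intro x hx hk
      obtain ⟨l', r1, j, hl', hv', -⟩ := hkill x y hx hy hk
      obtain rfl := hexcl y l l' hy (hlt hl).le (hlt hl').le hv hv'
      rw [hl] at hl'
      simp at hl'
    have hy' : (∃ l, P[l]? = some (.inc r') ∧ l + 2 ∈ v y y) ↔ r' = r := by
      constructor
      · rintro ⟨l', hl', hv'⟩
        obtain rfl := hexcl y l l' hy (hlt hl).le (hlt hl').le hv hv'
        rw [hl] at hl'
        simpa using hl'.symm
      · rintro rfl
        exact ⟨l, hl, hv⟩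
    have hmem : ∀ x, x ∈ threads P v (y + 1) r' ↔ x ∈ threads P v y r' ∨ (x = y ∧ r' = r) := by
      intro x
      rw [mem_threads, mem_threads]
      constructor
      · rintro ⟨h1, h2, h3⟩
        rcases Nat.lt_succ_iff_lt_or_eq.1 h1 with h1 | rfl
        · exact Or.inl ⟨h1, h2, fun z hz hz' => h3 z hz (by omega)⟩
        · exact Or.inr ⟨rfl, hy'.1 h2⟩
      · rintro (⟨h1, h2, h3⟩ | ⟨rfl, h⟩)
        · refine ⟨by omega, h2, fun z hz hz' => ?_⟩
          rcases Nat.lt_succ_iff_lt_or_eq.1 hz' with hz' | rfl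
          · exact h3 z hz hz'
          · exact hno x h1.le
        · refine ⟨by omega, hy'.2 h, fun z hz hz' => ?_⟩
          obtain rfl : z = x := by omega
          exact hno _ le_rfl
    ext x
    rw [hmem]
    split_ifs with hr <;> simp [hr, or_comm]
  have hcardinc : ∀ y l r, y ≤ k → P[l]? = some (.inc r) → l + 2 ∈ v y y →
      (fun r' => (threads P v (y + 1) r').card) = Function.update
        (fun r' => (threads P v y r').card) r ((threads P v y r).card + 1) := by
    intro y l r hy hl hv
    funext r'
    rw [hinc y l r hy hl hv, Function.update_apply]
    split_ifs with hr
    · subst hr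
      rw [Finset.card_insert_of_notMem]
      intro hmem
      have := (mem_threads.1 hmem).1
      omega
    · rfl
  have hdec : ∀ y l r j, y ≤ k → P[l]? = some (.dec r j) → l + 2 ∈ v y y →
      ∀ r' x, x ∈ threads P v (y + 1) r' ↔ x ∈ threads P v y r' ∧ 1 ∉ v x y := by
    intro y l r j hy hl hv r' x
    rw [mem_threads, mem_threads]
    constructor
    · rintro ⟨h1, h2, h3⟩
      -- No thread is created at `y`, where the instruction is a decrement.
      have hxy : x ≠ y := by
        rintro rfl
        obtain ⟨l', hl', hv'⟩ := h2
        obtain rfl := hexcl x l l' hy (hlt hl).le (hlt hl').le hv hv'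
        rw [hl] at hl'
        simp at hl'
      exact ⟨⟨by omega, h2, fun z hz hz' => h3 z hz (by omega)⟩, h3 y (by omega) (by omega)⟩
    · rintro ⟨⟨h1, h2, h3⟩, h4⟩
      refine ⟨by omega, h2, fun z hz hz' => ?_⟩
      rcases Nat.lt_succ_iff_lt_or_eq.1 hz' with hz' | rfl
      · exact h3 z hz hz'
      · exact h4
  -- the input phase
  have hin0' : ∀ y ≤ n, 0 + 2 ∈ v y y := fun y hy => hdiaA (x := 0) (by omega) (by omega) (hin0 y hy)
  have hin1' : 1 + 2 ∈ v (n + 1) (n + 1) := hdiaA (x := 0) hnk hP1.le hin1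
  have hcount : ∀ y ≤ n + 1, (fun r => (threads P v y r).card) =
      Function.update (fun _ => 0) 0 y := by
    intro y
    induction y with
    | zero =>
      intro _
      funext r
      simp [threads]
    | succ y ih =>
      intro hy
      have ih := ih (by omega)
      rw [hcardinc y 0 0 (by omega) hP0 (hin0' y (by omega)), ih, congrFun ih 0]
      simp
  -- the run of the machine
  have hrun : ∀ d, n + 1 + d ≤ k →
      (∃ t, ((step P)^[t] (1, Function.update (fun _ => 0) 0 (n + 1))).1 = P.length) ∨
      ∃ l, l ≠ 0 ∧ l < P.length ∧ l + 2 ∈ v (n + 1 + d) (n + 1 + d) ∧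
        (step P)^[d] (1, Function.update (fun _ => 0) 0 (n + 1)) =
          (l, fun r => (threads P v (n + 1 + d) r).card) := by
    -- The simulation ends once the address `P.length` is reached, since no `rule` governs what
    -- follows.
    have finish : ∀ d l, l ≠ 0 → l ≤ P.length → l + 2 ∈ v (n + 1 + d) (n + 1 + d) →
        (step P)^[d] (1, Function.update (fun _ => 0) 0 (n + 1)) =
          (l, fun r => (threads P v (n + 1 + d) r).card) →
        (∃ t, ((step P)^[t] (1, Function.update (fun _ => 0) 0 (n + 1))).1 = P.length) ∨
        ∃ l, l ≠ 0 ∧ l < P.length ∧ l + 2 ∈ v (n + 1 + d) (n + 1 + d) ∧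
          (step P)^[d] (1, Function.update (fun _ => 0) 0 (n + 1)) =
            (l, fun r => (threads P v (n + 1 + d) r).card) := by
      intro d l h0 hl hv hs
      rcases hl.lt_or_eq with hl | hl
      · exact Or.inr ⟨l, h0, hl, hv, hs⟩
      · exact Or.inl ⟨d, by rw [hs, hl]⟩
    intro d
    induction d with
    | zero =>
      intro _
      refine finish 0 1 one_ne_zero hP1.le hin1' ?_
      rw [Function.iterate_zero_apply, add_zero, hcount (n + 1) le_rfl]
    | succ d ih =>
      intro hd
      rcases ih (by omega) with h | ⟨l, hl0, hl, hv, hs⟩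
      · exact Or.inl h
      set y := n + 1 + d with hy
      have hR := hrule y l (by omega) hl hl0 hv
      obtain ⟨c, hc⟩ : ∃ c, P[l]? = some c := ⟨_, List.getElem?_eq_getElem hl⟩
      rw [rule, hc] at hR
      rcases c with r | ⟨r, j⟩
      · refine finish (d + 1) (l + 1) (by omega) hl ?_ ?_
        · exact hdiaA (x := y) (y := y + 1) (by omega) hl hR
        · rw [Function.iterate_succ_apply', hs, step_inc hc, ← add_assoc,
            hcardinc y l r (by omega) hc hv]
      · have hmem := hdec y l r j (by omega) hc hv
        -- Either a thread is consumed at `y`, and then it is unique by `hsingle` and belongs to `r`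
        -- by `hkill`; or none is, and `r` has no live thread.
        rcases holds_or.1 hR with hR | hR
        · obtain ⟨⟨x, hx, hk⟩, hA⟩ := holds_and.1 hR
          obtain ⟨l1, r1, j1, hl1, hv1, l2, hl2, hv2⟩ := hkill x y hx (by omega) hk
          obtain rfl := hexcl y l l1 (by omega) hl.le (hlt hl1).le hv hv1
          obtain ⟨rfl, rfl⟩ : r = r1 ∧ j = j1 := by rw [hc] at hl1; simpa using hl1
          have hxy : x ≠ y := by
            intro hxy
            rw [hxy] at hv2
            obtain rfl := hexcl y l l2 (by omega) hl.le (hlt hl2).le hv hv2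
            rw [hc] at hl2
            simp at hl2
          have hxS : x ∈ threads P v y r := mem_threads.2 ⟨by omega, ⟨l2, hl2, hv2⟩,
            fun z hz hzy => honce x y z hz hzy (by omega) hk⟩
          refine finish (d + 1) (l + 1) (by omega) hl ?_ ?_
          · exact hdiaA (x := y) (y := y + 1) (by omega) hl hA
          · rw [Function.iterate_succ_apply', hs, step_dec_pos hc (Finset.card_ne_zero_of_mem hxS),
              ← add_assoc]
            refine congrArg _ (funext fun r' => ?_)
            rw [Function.update_apply]
            split_ifs with hr
            · subst hr
              rw [← Finset.card_erase_of_mem hxS]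
              congr 1
              ext x'
              rw [Finset.mem_erase, hmem]
              constructor
              · rintro ⟨hne, hx'⟩
                exact ⟨hx', fun hk' =>
                  hne (hsingle y x' x (by omega) (mem_threads.1 hx').1.le hx hk' hk)⟩
              · rintro ⟨hx', hk'⟩
                exact ⟨fun h => hk' (h ▸ hk), hx'⟩
            · congr 1
              ext x'
              rw [hmem]
              refine (and_iff_left_of_imp fun hx' hk' => hr ?_).symm
              obtain rfl := hsingle y x' x (by omega) (mem_threads.1 hx').1.le hx hk' hk
              obtain ⟨l3, hl3, hv3⟩ := (mem_threads.1 hx').2.1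
              obtain rfl := hexcl x' l2 l3 (by omega) (hlt hl2).le (hlt hl3).le hv2 hv3
              rw [hl2] at hl3
              simpa using hl3.symm
        · obtain ⟨hno, hR⟩ := holds_and.1 hR
          obtain ⟨hempty, hA⟩ := holds_and.1 hR
          have hno' : ∀ x ≤ y, 1 ∉ v x y := fun x hx hk => hno ⟨x, hx, hk⟩
          have hzero : (threads P v y r).card = 0 := by
            rw [Finset.card_eq_zero, Finset.eq_empty_iff_forall_notMem]
            intro x hx
            obtain ⟨h1, ⟨l1, h2, h2'⟩, h3⟩ := mem_threads.1 hx
            refine hempty ⟨x, h1.le, holds_and.2 ⟨⟨x, le_rfl, holds_incs.2 ⟨l1, h2, h2'⟩⟩, ?_⟩⟩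
            rintro ⟨z, hz, hz', hk⟩
            exact h3 z hz hz' hk
          have hj := hjump r j (List.mem_of_getElem? hc)
          refine finish (d + 1) j hj.1 hj.2 ?_ ?_
          · exact hdiaA (x := y) (y := y + 1) (by omega) hj.2 hA
          · rw [Function.iterate_succ_apply', hs, step_dec_zero hc hzero, ← add_assoc]
            refine congrArg _ (funext fun r' => ?_)
            congr 1
            ext x'
            rw [hmem]
            exact (and_iff_left_of_imp fun hx' => hno' x' (mem_threads.1 hx').1.le).symm
  obtain ⟨y, hy0, hyk, hz⟩ := hhalt
  have hy := hdiaA (x := 0) hyk le_rfl hz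
  have hny : n + 1 ≤ y := by
    by_contra hc
    have := hexcl y _ _ hyk (by omega) le_rfl (hin0' y (by omega)) hy
    omega
  obtain ⟨d, rfl⟩ := Nat.exists_eq_add_of_le hny
  rcases hrun d hyk with h | ⟨l, -, hl, hv, -⟩
  · exact h
  · have := hexcl _ _ _ hyk hl.le le_rfl hv hy
    omega

/-! ### Requests whose truth values Duplicator can foresee. -/

/-- The labels `W`, where Spoiler's letter is put on the intervals in `σ`. -/
def marked (W : ℕ → ℕ → Set ℕ) (σ : ℕ → ℕ → Prop) (x y : ℕ) : Set ℕ :=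
  {a | (a = 0 ∧ σ x y) ∨ (a ≠ 0 ∧ a ∈ W x y)}

theorem zero_mem_marked {W : ℕ → ℕ → Set ℕ} {σ : ℕ → ℕ → Prop} {x y : ℕ} :
    0 ∈ marked W σ x y ↔ σ x y := by simp [marked]

theorem succ_mem_marked {W : ℕ → ℕ → Set ℕ} {σ : ℕ → ℕ → Prop} {x y a : ℕ} :
    a + 1 ∈ marked W σ x y ↔ a + 1 ∈ W x y := by simp [marked]

/-- The truth value of `ψ` on an interval depends only on the marks on the intervals that end
earlier. -/
def Foreseeable (k : ℕ) (W : ℕ → ℕ → Set ℕ) (ψ : Formula) : Prop :=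
  ∀ (σ τ : ℕ → ℕ → Prop) (x y : ℕ), x ≤ y → y ≤ k →
    (∀ x' y', x' ≤ y' → y' < y → (σ x' y' ↔ τ x' y')) →
    (Holds k (marked W σ) x y ψ ↔ Holds k (marked W τ) x y ψ)

/-- All requests of `ψ` are foreseeable. -/
def Predictable (k : ℕ) (W : ℕ → ℕ → Set ℕ) (ψ : Formula) : Prop :=
  ∀ χ ∈ ψ.subformulas, χ.IsRequest → Foreseeable k W χ

/-- Spoiler's letter does not occur. -/
def MarkFree : Formula → Prop
  | letter a => a ≠ 0
  | neg ψ => MarkFree ψ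
  | or ψ χ => MarkFree ψ ∧ MarkFree χ
  | diaA ψ => MarkFree ψ
  | diaAbar ψ => MarkFree ψ
  | diaB ψ => MarkFree ψ
  | diaBbar ψ => MarkFree ψ

section
variable {k : ℕ} {W : ℕ → ℕ → Set ℕ} {φ ψ : Formula}

theorem MarkFree.holds_iff (h : MarkFree ψ) (σ τ : ℕ → ℕ → Prop) (x y : ℕ) :
    Holds k (marked W σ) x y ψ ↔ Holds k (marked W τ) x y ψ := by
  induction ψ generalizing x y with
  | letter a => obtain ⟨a, rfl⟩ := Nat.exists_eq_succ_of_ne_zero h; simp [succ_mem_marked]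
  | neg ψ ih => simp only [holds_neg, ih h]
  | or ψ χ ih1 ih2 => simp only [holds_or, ih1 h.1, ih2 h.2]
  | diaA ψ ih => simp only [holds_diaA, ih h]
  | diaAbar ψ ih => simp only [holds_diaAbar, ih h]
  | diaB ψ ih => simp only [holds_diaB, ih h]
  | diaBbar ψ ih => simp only [holds_diaBbar, ih h]

theorem MarkFree.foreseeable (h : MarkFree ψ) : Foreseeable k W ψ :=
  fun σ τ x y _ _ _ => h.holds_iff σ τ x y

theorem MarkFree.predictable (h : MarkFree ψ) : Predictable k W ψ := by
  induction ψ with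
  | letter a =>
    rintro _ rfl hr
    exact MarkFree.foreseeable h
  | neg ψ ih =>
    rintro χ (rfl | hχ) hr
    · exact MarkFree.foreseeable h
    · exact ih h χ hχ hr
  | or ψ χ ih1 ih2 =>
    rintro χ ((rfl | hχ) | hχ) hr
    · exact MarkFree.foreseeable h
    · exact ih1 h.1 _ hχ hr
    · exact ih2 h.2 _ hχ hr
  | diaA ψ ih =>
    rintro χ (rfl | hχ) hr
    · exact MarkFree.foreseeable h
    · exact ih h χ hχ hr
  | diaAbar ψ ih =>
    rintro χ (rfl | hχ) hr
    · exact MarkFree.foreseeable h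
    · exact ih h χ hχ hr
  | diaB ψ ih =>
    rintro χ (rfl | hχ) hr
    · exact MarkFree.foreseeable h
    · exact ih h χ hχ hr
  | diaBbar ψ ih =>
    rintro χ (rfl | hχ) hr
    · exact MarkFree.foreseeable h
    · exact ih h χ hχ hr

theorem Foreseeable.neg (h : Foreseeable k W ψ) : Foreseeable k W (neg ψ) :=
  fun σ τ x y hxy hy hσ => not_congr (h σ τ x y hxy hy hσ)

theorem Foreseeable.and (h1 : Foreseeable k W φ) (h2 : Foreseeable k W ψ) :
    Foreseeable k W (and φ ψ) := fun σ τ x y hxy hy hσ => by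
  rw [holds_and, holds_and, h1 σ τ x y hxy hy hσ, h2 σ τ x y hxy hy hσ]

/-- The intervals reached end at `x ≤ y`, so only marks that end before `x` matter. For `diaA` there
is no such argument. -/
theorem Foreseeable.diaAbar (h : Foreseeable k W ψ) : Foreseeable k W (diaAbar ψ) :=
  fun σ τ x y hxy hy hσ => exists_congr fun z => and_congr_right fun hz =>
    h σ τ z x hz (by omega) fun x' y' h1 h2 => hσ x' y' h1 (by omega)

theorem Predictable.neg (h : Predictable k W ψ) : Predictable k W (neg ψ) := by
  rintro χ (rfl | hχ) hr
  · obtain ⟨ψ, h | h | h | h⟩ := hr <;> cases h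
  · exact h χ hχ hr

theorem Predictable.and (h1 : Predictable k W φ) (h2 : Predictable k W ψ) :
    Predictable k W (and φ ψ) := by
  refine Predictable.neg ?_
  rintro χ ((rfl | hχ) | hχ) hr
  · obtain ⟨ψ, h | h | h | h⟩ := hr <;> cases h
  · exact h1.neg χ hχ hr
  · exact h2.neg χ hχ hr

theorem predictable_letter (a : ℕ) : Predictable k W (letter a) := by
  rintro _ rfl hr
  obtain ⟨ψ, h | h | h | h⟩ := hr <;> cases h

theorem Predictable.diaA (h : Predictable k W ψ) (h' : Foreseeable k W (diaA ψ)) :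
    Predictable k W (diaA ψ) := by
  rintro χ (rfl | hχ) hr
  exacts [h', h χ hχ hr]

theorem Predictable.diaAbar (h : Predictable k W ψ) (h' : Foreseeable k W (diaAbar ψ)) :
    Predictable k W (diaAbar ψ) := by
  rintro χ (rfl | hχ) hr
  exacts [h', h χ hχ hr]

theorem Predictable.diaB (h : Predictable k W ψ) (h' : Foreseeable k W (diaB ψ)) :
    Predictable k W (diaB ψ) := by
  rintro χ (rfl | hχ) hr
  exacts [h', h χ hχ hr]

theorem Predictable.diaBbar (h : Predictable k W ψ) (h' : Foreseeable k W (diaBbar ψ)) :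
    Predictable k W (diaBbar ψ) := by
  rintro χ (rfl | hχ) hr
  exacts [h', h χ hχ hr]

end

theorem markFree_conj {l : List Formula} (h : ∀ φ ∈ l, MarkFree φ) : MarkFree (conj l) := by
  induction l with
  | nil => simp [conj, top, MarkFree]
  | cons φ l ih =>
    exact ⟨h φ (by simp), ih fun ψ hψ => h ψ (by simp [hψ])⟩

theorem markFree_disj {l : List Formula} (h : ∀ φ ∈ l, MarkFree φ) : MarkFree (disj l) := by
  induction l with
  | nil => simp [disj, top, MarkFree]
  | cons φ l ih =>
    exact ⟨h φ (by simp), ih fun ψ hψ => h ψ (by simp [hψ])⟩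

theorem markFree_incs (P : List Instr) (r : ℕ) : MarkFree (incs P r) := by
  refine markFree_disj fun φ hφ => ?_
  obtain ⟨l, -, rfl⟩ := List.mem_map.1 hφ
  simp [MarkFree]

theorem markFree_lawful (P : List Instr) : MarkFree (lawful P) := by
  refine ⟨markFree_conj ?_, markFree_conj ?_, ?_, ⟨?_, markFree_disj ?_⟩, ?_, markFree_conj ?_⟩
  · intro φ hφ
    obtain ⟨l, -, rfl⟩ := List.mem_map.1 hφ
    simp [MarkFree, imp, top]
  · intro φ hφ
    obtain ⟨l, -, hφ⟩ := List.mem_flatMap.1 hφ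
    obtain ⟨l', -, rfl⟩ := List.mem_map.1 hφ
    split_ifs <;> simp [MarkFree, and, top]
  · simp [MarkFree, imp]
  · simp [MarkFree]
  · intro φ hφ
    obtain ⟨l, -, rfl⟩ := List.mem_map.1 hφ
    rw [killer]
    rcases P[l]? with _ | (r | ⟨r, j⟩) <;> simp [MarkFree, top, and, markFree_incs]
  · simp [MarkFree, unit, and, top]
  · intro φ hφ
    obtain ⟨l, -, rfl⟩ := List.mem_map.1 hφ
    split_ifs
    · simp [MarkFree, top]
    · rw [rule]
      rcases P[l]? with _ | (r | ⟨r, j⟩) <;> simp [MarkFree, imp, top, and, markFree_incs]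

theorem markFree_iterate_diaB (j : ℕ) : MarkFree (diaB^[j] top) := by
  induction j with
  | zero => simp [MarkFree, top]
  | succ j ih => rwa [Function.iterate_succ_apply']

theorem markFree_input (n : ℕ) : MarkFree (input n) :=
  ⟨markFree_iterate_diaB _, markFree_iterate_diaB _, by simp [MarkFree, and]⟩

/-- A specification whose fault formula is never true has only predictable requests. -/
theorem predictable_spec {k : ℕ} {W : ℕ → ℕ → Set ℕ} {P : List Instr} {n : ℕ}
    (h : ∀ σ x y, x ≤ y → y ≤ k → Holds k (marked W σ) x y (lawful P) ∧
      Holds k (marked W σ) x y unmixed) : Predictable k W (spec P n) := by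
  have hk : ∀ ψ, (ψ = mark ∨ ψ = neg mark) →
      Predictable k W (killedWith ψ) ∧ Foreseeable k W (killedWith ψ) := by
    intro ψ hψ
    have h1 : MarkFree (neg (diaB (diaB kill))) := by simp [MarkFree]
    -- The marks inspected lie on intervals ending strictly before `y`; this is the benefit of the
    -- delay in `killedWith`.
    have h2 : Foreseeable k W (diaB (and kill ψ)) := by
      intro σ τ x y hxy hy hσ
      refine exists_congr fun z => and_congr_right fun hz => and_congr_right fun hzy => ?_
      have := hσ x z hz hzy
      rcases hψ with rfl | rfl <;>
        simp only [holds_and, holds_neg, holds_letter, zero_mem_marked, succ_mem_marked, this]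
    have h3 : Predictable k W ψ := by
      rcases hψ with rfl | rfl
      · exact predictable_letter 0
      · exact (predictable_letter 0).neg
    exact ⟨h1.predictable.and (((predictable_letter 1).and h3).diaB h2), h1.foreseeable.and h2⟩
  have h1 := hk mark (Or.inl rfl)
  have h2 := hk (neg mark) (Or.inr rfl)
  have hu : Predictable k W unmixed :=
    ((h1.1.diaAbar h1.2.diaAbar).and (h2.1.diaAbar h2.2.diaAbar)).neg
  have hno : ∀ σ x y, y ≤ k → ¬ Holds k (marked W σ) x y (fault P) := by
    rintro σ x y hy ⟨z, h1, h2, h3⟩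
    exact h3 (holds_and.2 (h σ y z h1 h2))
  -- `fault` looks into the future, but it is false under all marks and therefore foreseeable.
  have hf : Predictable k W (fault P) :=
    ((markFree_lawful P).predictable.and hu).neg.diaA fun σ τ x y _ hy _ =>
      iff_of_false (hno σ x y hy) (hno τ x y hy)
  refine (markFree_input n).predictable.and (hf.neg.and ((hf.diaBbar ?_).neg.and
    (MarkFree.predictable (by simp [MarkFree]))))
  intro σ τ x y _ _ _
  refine iff_of_false ?_ ?_ <;> rintro ⟨z, -, hz, h⟩
  exacts [hno _ _ _ hz h, hno _ _ _ hz h]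

theorem mem_subformulas_and_left {χ φ ψ : Formula} (h : χ ∈ φ.subformulas) :
    χ ∈ (and φ ψ).subformulas := Or.inr (Or.inl (Or.inr (Or.inr h)))

theorem mem_subformulas_and_right {χ φ ψ : Formula} (h : χ ∈ ψ.subformulas) :
    χ ∈ (and φ ψ).subformulas := Or.inr (Or.inr (Or.inr h))

/-- An instance is only admissible if Spoiler's letter belongs to the alphabet of the formula. -/
theorem mark_mem_subformulas_spec (P : List Instr) (n : ℕ) : mark ∈ (spec P n).subformulas := by
  have h1 : mark ∈ (killedWith mark).subformulas :=
    mem_subformulas_and_right (Or.inr (mem_subformulas_and_right (self_mem_subformulas _)))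
  have h2 : mark ∈ unmixed.subformulas := Or.inr (mem_subformulas_and_left (Or.inr h1))
  have h3 : mark ∈ (fault P).subformulas := Or.inr (Or.inr (mem_subformulas_and_right h2))
  exact mem_subformulas_and_right (mem_subformulas_and_left (Or.inr h3))

end Formula

/-! ### The honest model of a halting run. -/

/-- The run of a machine in which the counters are sets of threads: first `n + 1` input threads are
created, and then the machine proceeds from the address `1`. -/
noncomputable def threadRun (P : List Instr) (n : ℕ) : ℕ → ℕ × (ℕ → Finset ℕ)
  | 0 => (0, fun _ => ∅)
  | y + 1 =>
    let c := threadRun P n y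
    match P[c.1]? with
    | none => c
    | some (.inc r) => (if y < n then 0 else c.1 + 1, Function.update c.2 r (insert y (c.2 r)))
    | some (.dec r j) =>
      if c.2 r = ∅ then (j, c.2)
      else (c.1 + 1, Function.update c.2 r ((c.2 r).erase (sInf (c.2 r : Set ℕ))))

/-- The thread `x` is consumed at the time `y`. -/
def Kills (P : List Instr) (n x y : ℕ) : Prop :=
  ∃ r j, P[(threadRun P n y).1]? = some (.dec r j) ∧ x ∈ (threadRun P n y).2 r ∧
    x = sInf ((threadRun P n y).2 r : Set ℕ)

/-- Duplicator's labels. -/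
def threadLabels (P : List Instr) (n x y : ℕ) : Set ℕ :=
  {a | (a = 1 ∧ Kills P n x y) ∨ (x = y ∧ a = (threadRun P n y).1 + 2)}

section
variable {P : List Instr} {n : ℕ}

theorem one_mem_threadLabels {x y : ℕ} : 1 ∈ threadLabels P n x y ↔ Kills P n x y := by
  simp [threadLabels]

theorem addr_mem_threadLabels {x y l : ℕ} :
    l + 2 ∈ threadLabels P n x y ↔ x = y ∧ l = (threadRun P n y).1 := by
  simp [threadLabels]

theorem threadRun_inc {y r : ℕ} (h : P[(threadRun P n y).1]? = some (.inc r)) :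
    threadRun P n (y + 1) = (if y < n then 0 else (threadRun P n y).1 + 1,
      Function.update (threadRun P n y).2 r (insert y ((threadRun P n y).2 r))) := by
  rw [threadRun, h]

theorem threadRun_dec_empty {y r j : ℕ} (h : P[(threadRun P n y).1]? = some (.dec r j))
    (hr : (threadRun P n y).2 r = ∅) : threadRun P n (y + 1) = (j, (threadRun P n y).2) := by
  rw [threadRun, h]
  simp [hr]

theorem threadRun_dec {y r j : ℕ} (h : P[(threadRun P n y).1]? = some (.dec r j))
    (hr : (threadRun P n y).2 r ≠ ∅) : threadRun P n (y + 1) = ((threadRun P n y).1 + 1,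
      Function.update (threadRun P n y).2 r (((threadRun P n y).2 r).erase
        (sInf ((threadRun P n y).2 r : Set ℕ)))) := by
  rw [threadRun, h]
  simp [hr]

theorem lt_of_mem_threadRun {x y r : ℕ} (h : x ∈ (threadRun P n y).2 r) : x < y := by
  induction y generalizing r with
  | zero => simp [threadRun] at h
  | succ y ih =>
    rcases hc : P[(threadRun P n y).1]? with _ | (r' | ⟨r', j⟩)
    · rw [threadRun, hc] at h
      exact (ih h).trans (Nat.lt_succ_self y)
    · rw [threadRun_inc hc] at h
      simp only [Function.update_apply] at h
      split_ifs at h with hr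
      · rcases Finset.mem_insert.1 h with rfl | h
        · exact Nat.lt_succ_self x
        · exact (ih h).trans (Nat.lt_succ_self y)
      · exact (ih h).trans (Nat.lt_succ_self y)
    · by_cases hr' : (threadRun P n y).2 r' = ∅
      · rw [threadRun_dec_empty hc hr'] at h
        exact (ih h).trans (Nat.lt_succ_self y)
      · rw [threadRun_dec hc hr'] at h
        simp only [Function.update_apply] at h
        split_ifs at h with hr
        · exact (ih (Finset.mem_of_mem_erase h)).trans (Nat.lt_succ_self y)
        · exact (ih h).trans (Nat.lt_succ_self y)

theorem Kills.lt {x y : ℕ} (h : Kills P n x y) : x < y := by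
  obtain ⟨r, j, -, h, -⟩ := h
  exact lt_of_mem_threadRun h

theorem Kills.eq {x x' y : ℕ} (h : Kills P n x y) (h' : Kills P n x' y) : x = x' := by
  obtain ⟨r, j, h1, -, h2⟩ := h
  obtain ⟨r', j', h1', -, h2'⟩ := h'
  rw [h1] at h1'
  simp only [Option.some.injEq, Instr.dec.injEq] at h1'
  rw [h2, h2', h1'.1]

/-- Expresses the live threads through creation and consumption alone, which is how `rule` sees
them. -/
theorem mem_threadRun {x y r : ℕ} : x ∈ (threadRun P n y).2 r ↔
    x < y ∧ P[(threadRun P n x).1]? = some (.inc r) ∧ ∀ z < y, ¬ Kills P n x z := by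
  induction y generalizing x r with
  | zero => simp [threadRun]
  | succ y ih =>
    have key : x ∈ (threadRun P n (y + 1)).2 r ↔
        (x ∈ (threadRun P n y).2 r ∧ ¬ Kills P n x y) ∨
          (x = y ∧ P[(threadRun P n y).1]? = some (.inc r)) := by
      rcases hc : P[(threadRun P n y).1]? with _ | (r' | ⟨r', j⟩)
      · have hk : ¬ Kills P n x y := by rintro ⟨r, j, h, -⟩; rw [hc] at h; cases h
        rw [threadRun, hc]
        simp [hk]
      · have hk : ¬ Kills P n x y := by rintro ⟨r, j, h, -⟩; rw [hc] at h; cases h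
        rw [threadRun_inc hc]
        simp only [Function.update_apply]
        split_ifs with hr
        · simp [hk, hr, or_comm]
        · simp [hk, Ne.symm hr]
      · by_cases hr' : (threadRun P n y).2 r' = ∅
        · have hk : ¬ Kills P n x y := by
            rintro ⟨r, j', h, hx, -⟩
            rw [hc] at h
            simp only [Option.some.injEq, Instr.dec.injEq] at h
            rw [← h.1, hr'] at hx
            simp at hx
          rw [threadRun_dec_empty hc hr']
          simp [hk]
        · rw [threadRun_dec hc hr']
          simp only [Function.update_apply]
          have hne : ((threadRun P n y).2 r' : Set ℕ).Nonempty := by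
            simpa [Finset.nonempty_iff_ne_empty] using hr'
          have hk : Kills P n x y ↔ x = sInf ((threadRun P n y).2 r' : Set ℕ) := by
            constructor
            · rintro ⟨r, j', h, hx, hx'⟩
              rw [hc] at h
              simp only [Option.some.injEq, Instr.dec.injEq] at h
              rw [h.1, hx']
            · intro h
              exact ⟨r', j, hc, by rw [h]; exact Nat.sInf_mem hne, h⟩
          split_ifs with hr
          · simp [hk, hr, and_comm]
          · simp only [hk, Option.some.injEq, reduceCtorEq, and_false, or_false]
            -- A thread belongs to a single counter, determined by the instruction at its creation.
            refine (and_iff_left_of_imp fun hx hx' => hr ?_).symm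
            have h1 := (ih.1 hx).2.1
            have h2 := (ih.1 (hx' ▸ Nat.sInf_mem hne : x ∈ (threadRun P n y).2 r')).2.1
            rw [h1] at h2
            simpa using h2
    rw [key, ih]
    constructor
    · rintro (⟨⟨h1, h2, h3⟩, h4⟩ | ⟨rfl, h⟩)
      · refine ⟨by omega, h2, fun z hz => ?_⟩
        rcases Nat.lt_succ_iff_lt_or_eq.1 hz with hz | rfl
        · exact h3 z hz
        · exact h4
      · exact ⟨Nat.lt_succ_self x, h, fun z hz hk => by have := hk.lt; omega⟩
    · rintro ⟨h1, h2, h3⟩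
      rcases Nat.lt_succ_iff_lt_or_eq.1 h1 with h1 | rfl
      · exact Or.inl ⟨⟨h1, h2, fun z hz => h3 z (by omega)⟩, h3 y (by omega)⟩
      · exact Or.inr ⟨rfl, h2⟩

theorem threadRun_of_le (hP : P[0]? = some (.inc 0)) {y : ℕ} (hy : y ≤ n) :
    threadRun P n y = (0, Function.update (fun _ => ∅) 0 (Finset.range y)) := by
  induction y with
  | zero => simp [threadRun]
  | succ y ih =>
    have ih := ih (by omega)
    rw [threadRun_inc (r := 0) (by rw [ih]; exact hP), ih, if_pos (by omega)]
    simp [Finset.range_add_one]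

theorem threadRun_succ (hP : P[0]? = some (.inc 0)) :
    threadRun P n (n + 1) = (1, Function.update (fun _ => ∅) 0 (Finset.range (n + 1))) := by
  have h := threadRun_of_le (P := P) (n := n) hP le_rfl
  rw [threadRun_inc (r := 0) (by rw [h]; exact hP), h, if_neg (by omega)]
  simp [Finset.range_add_one]

theorem iterate_step_eq_threadRun (hP : P[0]? = some (.inc 0)) (t : ℕ) :
    (step P)^[t] (1, Function.update (fun _ => 0) 0 (n + 1)) =
      ((threadRun P n (n + 1 + t)).1, fun r => ((threadRun P n (n + 1 + t)).2 r).card) := by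
  induction t with
  | zero =>
    rw [add_zero, threadRun_succ hP]
    refine Prod.ext rfl (funext fun r => ?_)
    by_cases hr : r = 0 <;> simp [hr]
  | succ t ih =>
    rw [Function.iterate_succ_apply', ih, ← add_assoc]
    set y := n + 1 + t with hy
    rcases hc : P[(threadRun P n y).1]? with _ | (r | ⟨r, j⟩)
    · rw [threadRun, hc]
      simp [step, hc]
    · rw [step_inc hc, threadRun_inc hc, if_neg (by omega)]
      refine Prod.ext rfl (funext fun r' => ?_)
      simp only [Function.update_apply]
      split_ifs with hr
      · rw [Finset.card_insert_of_notMem fun h => lt_irrefl _ (lt_of_mem_threadRun h)]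
      · rfl
    · by_cases hr : (threadRun P n y).2 r = ∅
      · rw [step_dec_zero hc (by rw [hr]; rfl), threadRun_dec_empty hc hr]
      · have hne : ((threadRun P n y).2 r : Set ℕ).Nonempty := by
          simpa [Finset.nonempty_iff_ne_empty] using hr
        rw [step_dec_pos hc (by simpa using hr), threadRun_dec hc hr]
        refine Prod.ext rfl (funext fun r' => ?_)
        simp only [Function.update_apply]
        split_ifs with hr'
        · rw [Finset.card_erase_of_mem (Nat.sInf_mem hne)]
        · rfl

end

open Formula

section
variable {P : List Instr} {n k : ℕ} {σ : ℕ → ℕ → Prop} {x y : ℕ}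

theorem one_mem_marked_threadLabels :
    1 ∈ marked (threadLabels P n) σ x y ↔ Kills P n x y :=
  (succ_mem_marked (a := 0)).trans one_mem_threadLabels

theorem addr_mem_marked_threadLabels {l : ℕ} :
    l + 2 ∈ marked (threadLabels P n) σ x y ↔ x = y ∧ l = (threadRun P n y).1 :=
  (succ_mem_marked (a := l + 1)).trans addr_mem_threadLabels

theorem holds_diaAbar_incs_threadLabels {r : ℕ} :
    Holds k (marked (threadLabels P n) σ) x y (diaAbar (incs P r)) ↔
      P[(threadRun P n x).1]? = some (.inc r) := by
  simp only [holds_diaAbar, holds_incs, addr_mem_marked_threadLabels]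
  constructor
  · rintro ⟨z, -, l, hl, rfl, rfl⟩
    exact hl
  · intro h
    exact ⟨x, le_rfl, _, h, rfl, rfl⟩

theorem holds_diaA_addr_threadLabels {l : ℕ} (hy : y ≤ k) :
    Holds k (marked (threadLabels P n) σ) x y (diaA (addr l)) ↔ l = (threadRun P n y).1 := by
  simp only [holds_diaA, holds_letter, addr_mem_marked_threadLabels]
  constructor
  · rintro ⟨z, -, -, rfl, rfl⟩
    rfl
  · rintro rfl
    exact ⟨y, le_rfl, hy, rfl, rfl⟩

theorem holds_diaAbar_kill_threadLabels :
    Holds k (marked (threadLabels P n) σ) x y (diaAbar kill) ↔ ∃ z, Kills P n z x := by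
  simp only [holds_diaAbar, holds_letter, one_mem_marked_threadLabels]
  exact ⟨fun ⟨z, _, h⟩ => ⟨z, h⟩, fun ⟨z, h⟩ => ⟨z, h.lt.le, h⟩⟩

theorem holds_lawful_threadLabels (hP : P[0]? = some (.inc 0)) (hy : y ≤ k) :
    Holds k (marked (threadLabels P n) σ) x y (lawful P) := by
  rw [holds_lawful]
  simp only [one_mem_marked_threadLabels, addr_mem_marked_threadLabels,
    holds_diaAbar_incs_threadLabels, holds_diaA_addr_threadLabels hy]
  refine ⟨fun l _ h => h.1.ge, fun l _ l' _ h h' => h.2.trans h'.2.symm, fun h z _ hz => ?_,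
    fun h => ?_, ?_⟩
  · obtain ⟨r, j, -, h, -⟩ := h
    exact (mem_threadRun.1 h).2.2 z hz
  · obtain ⟨r, j, h1, h, -⟩ := h
    exact ⟨_, r, j, h1, (mem_threadRun.1 h).2.1, rfl⟩
  · rintro rfl l hl h0 ⟨z, -, -, rfl⟩
    -- Up to the time `n` the address is `0`, which is exempt from `rule`; so only the computation
    -- phase is left.
    have hx : n < x := by
      by_contra hx
      rw [threadRun_of_le hP (by omega)] at h0
      exact h0 rfl
    rcases hc : P[(threadRun P n x).1]? with _ | (r | ⟨r, j⟩) <;> rw [rule, hc]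
    · exact holds_top
    · rw [holds_diaA_addr_threadLabels hy, threadRun_inc hc, if_neg (by omega)]
    · simp only [holds_or, holds_and, holds_neg, holds_diaA_addr_threadLabels hy,
        holds_diaAbar_kill_threadLabels]
      by_cases hr : (threadRun P n x).2 r = ∅
      · right
        rw [threadRun_dec_empty hc hr]
        refine ⟨?_, ?_, rfl⟩
        · rintro ⟨z, r', j', h, hz, -⟩
          rw [hc] at h
          simp only [Option.some.injEq, Instr.dec.injEq] at h
          rw [← h.1, hr] at hz
          simp at hz
        · rintro ⟨z, hz, h⟩
          rw [holds_and, holds_diaAbar_incs_threadLabels] at h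
          have hzx : z ≠ x := by
            rintro rfl
            rw [hc] at h
            simp at h
          have : z ∈ (threadRun P n x).2 r := by
            refine mem_threadRun.2 ⟨by omega, h.1, fun w hw hk => h.2 ⟨w, hk.lt.le, hw, ?_⟩⟩
            exact one_mem_marked_threadLabels.2 hk
          rw [hr] at this
          simp at this
      · left
        have hne : ((threadRun P n x).2 r : Set ℕ).Nonempty := by
          simpa [Finset.nonempty_iff_ne_empty] using hr
        rw [threadRun_dec hc hr]
        exact ⟨⟨_, r, j, hc, Nat.sInf_mem hne, rfl⟩, rfl⟩

/-- Both requests refer to the time just before `x`. Only one thread is consumed then, and it cannot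
be both marked and unmarked. -/
theorem holds_unmixed_threadLabels :
    Holds k (marked (threadLabels P n) σ) x y unmixed := by
  have key : ∀ z ψ, Holds k (marked (threadLabels P n) σ) z x (killedWith ψ) → ∃ w, x = w + 1 ∧
      Kills P n z w ∧ Holds k (marked (threadLabels P n) σ) z w ψ := by
    intro z ψ h
    obtain ⟨h1, w, hzw, hwx, h2⟩ := holds_and.1 h
    rw [holds_and, holds_letter, one_mem_marked_threadLabels] at h2
    refine ⟨w, ?_, h2⟩
    by_contra hne
    refine h1 ⟨w + 1, by omega, by omega, w, hzw, by omega, ?_⟩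
    exact one_mem_marked_threadLabels.2 h2.1
  rintro h
  obtain ⟨⟨z, -, hz⟩, ⟨z', -, hz'⟩⟩ := holds_and.1 h
  obtain ⟨w, hw, h1, h2⟩ := key z _ hz
  obtain ⟨w', hw', h1', h2'⟩ := key z' _ hz'
  obtain rfl : w = w' := by omega
  obtain rfl := h1.eq h1'
  exact h2' h2

end

/-- If the machine halts, then Duplicator has labels that satisfy the specification whatever
Spoiler marks, and such that all requests are foreseeable. -/
theorem exists_labels_of_halting {P : List Instr} {n : ℕ} (hP : P[0]? = some (.inc 0))
    (h : ∃ t, ((step P)^[t] (1, Function.update (fun _ => 0) 0 (n + 1))).1 = P.length) :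
    ∃ k W, (∀ σ, Holds k (marked W σ) 0 0 (spec P n)) ∧ Predictable k W (spec P n) := by
  obtain ⟨t, ht⟩ := h
  rw [iterate_step_eq_threadRun hP] at ht
  have hlaw : ∀ σ x y, x ≤ y → y ≤ n + 1 + t →
      Holds (n + 1 + t) (marked (threadLabels P n) σ) x y (lawful P) ∧
      Holds (n + 1 + t) (marked (threadLabels P n) σ) x y unmixed := fun σ x y _ hy =>
    ⟨holds_lawful_threadLabels hP hy, holds_unmixed_threadLabels⟩
  refine ⟨n + 1 + t, threadLabels P n, fun σ => holds_spec.2 ⟨holds_input.2 ⟨by omega, ?_, ?_⟩,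
    hlaw σ, n + 1 + t, by omega, le_rfl, n + 1 + t, le_rfl, le_rfl, ?_⟩, predictable_spec hlaw⟩
  · exact ⟨n + 1, le_rfl, by omega, addr_mem_marked_threadLabels.2 ⟨rfl, by rw [threadRun_succ hP]⟩⟩
  · exact fun y hy => ⟨y, le_rfl, by omega,
      addr_mem_marked_threadLabels.2 ⟨rfl, by rw [threadRun_of_le hP hy]⟩⟩
  · exact addr_mem_marked_threadLabels.2 ⟨rfl, ht.symm⟩


/-! ### Enumeration of the intervals, and admissible runs. -/

theorem triangle_succ (y : ℕ) : (y + 1) * (y + 2) / 2 = y * (y + 1) / 2 + (y + 1) := by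
  have : (y + 1) * (y + 2) = y * (y + 1) + 2 * (y + 1) := by ring
  omega

theorem triangle_mono : Monotone fun y : ℕ => y * (y + 1) / 2 :=
  monotone_nat_of_le_succ fun y => by rw [triangle_succ]; omega

/-- The position of an interval in the enumeration by right and then by left endpoints. -/
def index (I : NonemptyInterval ℕ) : ℕ := I.snd * (I.snd + 1) / 2 + I.fst

/-- The enumeration of all intervals by right and then by left endpoints. -/
def enum : ℕ → NonemptyInterval ℕ
  | 0 => NonemptyInterval.pure 0
  | i + 1 =>
    if h : (enum i).fst < (enum i).snd then ⟨((enum i).fst + 1, (enum i).snd), h⟩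
    else ⟨(0, (enum i).snd + 1), Nat.zero_le _⟩

theorem index_enum (i : ℕ) : index (enum i) = i := by
  induction i with
  | zero => rfl
  | succ i ih =>
    have hle := (enum i).fst_le_snd
    rw [enum]
    unfold index at *
    split_ifs with h
    · simp only; omega
    · simp only; rw [triangle_succ]; omega

theorem enum_injective : Function.Injective enum :=
  Function.LeftInverse.injective index_enum

theorem enum_index (I : NonemptyInterval ℕ) : enum (index I) = I := by
  obtain ⟨⟨x, y⟩, hxy⟩ := I
  change x ≤ y at hxy
  have key : ∀ y x (h : x ≤ y), enum (y * (y + 1) / 2 + x) = ⟨(x, y), h⟩ := by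
    intro y
    induction y with
    | zero =>
      intro x h
      obtain rfl : x = 0 := by omega
      rfl
    | succ y ih =>
      intro x
      induction x with
      | zero =>
        intro h
        have := ih y le_rfl
        rw [triangle_succ, add_zero, ← add_assoc, enum]
        simp [this]
      | succ x ihx =>
        intro h
        have := ihx (by omega)
        rw [← add_assoc, enum]
        have h' : x < y + 1 := h
        simp [this, h']
  exact key y x hxy

theorem index_injective : Function.Injective index :=
  Function.LeftInverse.injective enum_index

theorem index_lt_iff {I : NonemptyInterval ℕ} {k : ℕ} :
    index I < (k + 1) * (k + 2) / 2 ↔ I.snd ≤ k := by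
  have hle := I.fst_le_snd
  constructor
  · intro h
    by_contra hc
    have := triangle_mono (show k + 1 ≤ I.snd by omega)
    simp only [index] at h this
    have e : k + 1 + 1 = k + 2 := rfl
    rw [e] at this
    omega
  · intro h
    have := triangle_mono (show I.snd + 1 ≤ k + 1 by omega)
    simp only at this
    have e1 : k + 1 + 1 = k + 2 := rfl
    have e2 : I.snd + 1 + 1 = I.snd + 2 := rfl
    rw [e1, e2, triangle_succ] at this
    rw [index]
    omega

theorem infiniteRun_of_enum {S P : Set Formula} {ρ : ℕ → Move}
    (h1 : ∀ j, (ρ j).1 = enum (j / 2)) (h2 : ∀ i, (ρ (2 * i)).2 ⊆ P)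
    (h3 : ∀ i, (ρ (2 * i + 1)).2 ⊆ S \ P) : InfiniteRun S P ρ := by
  refine ⟨⟨by rw [h1]; rfl, ?_, ?_, ?_, ?_, ?_⟩, fun I => ⟨2 * index I, ?_⟩⟩
  · rintro i ⟨a, rfl⟩ -
    refine ⟨WithTop.coe_lt_top _, ?_⟩
    rw [h1, h1]
    congr 1
    omega
  · rintro i ⟨a, rfl⟩ -
    rw [← two_mul]
    exact h2 a
  · rintro i ⟨a, rfl⟩ -
    rw [← two_mul]
    exact h3 a
  · rintro i j ⟨a, rfl⟩ - - hj1 hj2 h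
    rw [h1, h1] at h
    have := enum_injective h
    omega
  · rintro i - h
    rw [h1, h1] at h ⊢
    -- The interval can change only after an answer of Duplicator, that is, between two rounds.
    have hi : (i + 1) / 2 = i / 2 + 1 := by
      by_contra hc
      exact h (by rw [show (i + 1) / 2 = i / 2 by omega])
    have hidx := index_enum (i / 2 + 1)
    rw [hi] at h ⊢
    have hlt : ¬ (enum (i / 2)).fst < (enum (i / 2)).snd := by
      intro hlt
      exact h (by rw [enum, dif_pos hlt])
    have he : enum (i / 2 + 1) = ⟨(0, (enum (i / 2)).snd + 1), Nat.zero_le _⟩ := by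
      rw [enum, dif_neg hlt]
    rw [he] at hidx ⊢
    refine ⟨rfl, fun I hI => ⟨2 * index I, ?_, ?_⟩⟩
    · have := index_lt_iff.2 (Nat.lt_succ_iff.1 hI)
      simp only [index] at this hidx ⊢
      rw [add_zero, show (enum (i / 2)).snd + 1 + 1 = (enum (i / 2)).snd + 2 from rfl] at hidx
      omega
    · rw [h1, Nat.mul_div_cancel_left _ two_pos, enum_index]
  · rw [h1, Nat.mul_div_cancel_left _ two_pos, enum_index]

section
variable {S P : Set Formula} {ρ : ℕ → Move}

theorem InfiniteRun.fst_answer (h : InfiniteRun S P ρ) (a : ℕ) :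
    (ρ (2 * a + 1)).1 = (ρ (2 * a)).1 :=
  (h.1.answer (2 * a) (even_two_mul a) (WithTop.coe_lt_top _)).2.symm

theorem InfiniteRun.injective (h : InfiniteRun S P ρ) :
    Function.Injective fun a => (ρ (2 * a)).1 := by
  intro a b hab
  by_contra hne
  exact h.1.once (2 * a) (2 * b) (even_two_mul a) (WithTop.coe_lt_top _) (WithTop.coe_lt_top _)
    (by omega) (by omega) hab

/-- Going back in the run to a change of the right endpoint, where the rule `order` applies; such a
change exists because the run starts at `[0, 0]`. -/
theorem InfiniteRun.exists_lt (h : InfiniteRun S P ρ) (a : ℕ) {I : NonemptyInterval ℕ}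
    (hI : I.snd < (ρ (2 * a)).1.snd) : ∃ b < a, (ρ (2 * b)).1 = I := by
  have key : ∀ i, I.snd < (ρ i).1.snd → ∃ j < i, (ρ j).1 = I := by
    intro i
    induction i with
    | zero => intro hI; rw [h.1.start] at hI; exact absurd hI (Nat.not_lt_zero _)
    | succ i ih =>
      intro hI
      by_cases hs : (ρ (i + 1)).1.snd = (ρ i).1.snd
      · obtain ⟨j, hj, hj'⟩ := ih (hs ▸ hI)
        exact ⟨j, by omega, hj'⟩
      · exact (h.1.order i (WithTop.coe_lt_top _) hs).2 I hI
  obtain ⟨j, hj, hj'⟩ := key _ hI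
  refine ⟨j / 2, by omega, ?_⟩
  rcases Nat.mod_two_eq_zero_or_one j with hm | hm
  · rw [show 2 * (j / 2) = j by omega, hj']
  · rw [← h.fst_answer, show 2 * (j / 2) + 1 = j by omega, hj']

/-- By counting: a right endpoint beyond `k` requires that all `(k + 1) * (k + 2) / 2` intervals
over `0, …, k` were picked earlier, but there were only `a` rounds. -/
theorem InfiniteRun.snd_le (h : InfiniteRun S P ρ) {k a : ℕ} (ha : a < (k + 1) * (k + 2) / 2) :
    (ρ (2 * a)).1.snd ≤ k := by
  by_contra hc
  have : ∀ i, i < (k + 1) * (k + 2) / 2 → ∃ b < a, (ρ (2 * b)).1 = enum i := by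
    intro i hi
    refine h.exists_lt a ?_
    have := index_lt_iff.1 (show index (enum i) < (k + 1) * (k + 2) / 2 by rwa [index_enum])
    omega
  choose! g hg hg' using this
  have hcard := Finset.card_le_card_of_injOn (s := Finset.range ((k + 1) * (k + 2) / 2))
    (t := Finset.range a) g (fun i hi => by
      simpa using hg i (by simpa using hi)) (by
      intro i hi j hj hij
      have h1 := hg' i (by simpa using hi)
      rw [hij, hg' j (by simpa using hj)] at h1
      exact (enum_injective h1).symm)
  simp only [Finset.card_range] at hcard
  omega

/-- Pigeonhole: the first `(k + 1) * (k + 2) / 2` rounds treat distinct intervals over `0, …, k`,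
and there are just as many of those. -/
theorem InfiniteRun.exists_round (h : InfiniteRun S P ρ) {k : ℕ} {I : NonemptyInterval ℕ}
    (hI : I.snd ≤ k) : ∃ a < (k + 1) * (k + 2) / 2, (ρ (2 * a)).1 = I := by
  set T := (k + 1) * (k + 2) / 2
  have himg : (Finset.range T).image (fun a => index (ρ (2 * a)).1) = Finset.range T := by
    refine Finset.eq_of_subset_of_card_le ?_ ?_
    · intro i hi
      obtain ⟨a, ha, rfl⟩ := Finset.mem_image.1 hi
      exact Finset.mem_range.2 (index_lt_iff.2 (h.snd_le (Finset.mem_range.1 ha)))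
    · exact (Finset.card_image_of_injective _ (index_injective.comp h.injective)).ge
  have hmem : index I ∈ Finset.range T := Finset.mem_range.2 (index_lt_iff.2 hI)
  rw [← himg] at hmem
  obtain ⟨a, ha, haI⟩ := Finset.mem_image.1 hmem
  exact ⟨a, Finset.mem_range.1 ha, index_injective haI⟩

theorem two_mul_triangle (k : ℕ) : 2 * ((k + 1) * (k + 2) / 2) = (k + 1) * (k + 2) :=
  Nat.mul_div_cancel' (Nat.even_mul_succ_self (k + 1)).two_dvd

theorem InfiniteRun.finiteRun (h : InfiniteRun S P ρ) (k : ℕ) : FiniteRun S P k ρ := by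
  have hT := two_mul_triangle k
  refine ⟨⟨h.1.start, ?_, ?_, ?_, ?_, ?_⟩, ?_⟩
  · intro i hi hlt
    refine ⟨?_, (h.1.answer i hi (WithTop.coe_lt_top _)).2⟩
    rw [Nat.cast_lt] at hlt ⊢
    obtain ⟨a, rfl⟩ := hi
    omega
  · exact fun i hi _ => h.1.spoiler i hi (WithTop.coe_lt_top _)
  · exact fun i hi _ => h.1.duplicator i hi (WithTop.coe_lt_top _)
  · exact fun i j hi _ _ => h.1.once i j hi (WithTop.coe_lt_top _) (WithTop.coe_lt_top _)
  · exact fun i _ => h.1.order i (WithTop.coe_lt_top _)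
  · intro I hI
    obtain ⟨a, ha, haI⟩ := h.exists_round hI
    exact ⟨2 * a, by omega, haI⟩

/-- In a run, each interval over `0, …, k` gets its labels in a single round. -/
theorem InfiniteRun.mem_labelling (h : InfiniteRun S P ρ) {k a : ℕ}
    (ha : (ρ (2 * a)).1.snd ≤ k) (ψ : Formula) :
    ψ ∈ labelling ρ ((k + 1) * (k + 2)) (ρ (2 * a)).1 ↔
      ψ ∈ (ρ (2 * a)).2 ∨ ψ ∈ (ρ (2 * a + 1)).2 := by
  have hT := two_mul_triangle k
  constructor
  · rintro ⟨i, ⟨b, rfl⟩, hi, hI, hψ⟩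
    rw [← two_mul] at hI hψ
    obtain rfl := h.injective hI
    exact hψ
  · intro hψ
    obtain ⟨b, hb, hbI⟩ := h.exists_round ha
    obtain rfl := h.injective hbI
    exact ⟨2 * b, even_two_mul b, by omega, rfl, hψ⟩

end

/-! ### Histories and responses. -/

theorem initialSegment_congr {ρ ρ' : ℕ → Move} {n : ℕ} (h : ∀ j < n, ρ j = ρ' j) :
    initialSegment ρ n = initialSegment ρ' n :=
  List.map_congr_left fun j hj => h j (List.mem_range.1 hj)

theorem length_initialSegment (ρ : ℕ → Move) (n : ℕ) : (initialSegment ρ n).length = n := by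
  simp [initialSegment]

theorem mem_initialSegment {ρ : ℕ → Move} {n : ℕ} {e : Move} :
    e ∈ initialSegment ρ n ↔ ∃ j < n, ρ j = e := by
  simp [initialSegment]

/-- Course-of-values recursion, used to build plays in which each move depends on the history. -/
theorem exists_eq_initialSegment (F : List Move → Move) :
    ∃ ρ : ℕ → Move, ∀ j, ρ j = F (initialSegment ρ j) := by
  let hist : ℕ → List Move := fun j => Nat.rec [] (fun _ h => h ++ [F h]) j
  have key : ∀ j, initialSegment (fun j => F (hist j)) j = hist j := by
    intro j
    induction j with
    | zero => rfl
    | succ j ih =>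
      rw [initialSegment] at ih ⊢
      rw [List.range_succ, List.map_append, ih]
      rfl
  exact ⟨fun j => F (hist j), fun j => by rw [key]⟩

/-- `FiniteSynthesis` only provides some response; uniqueness identifies it with a play built by
hand. -/
theorem IsResponse.unique {f : List Move → Set Formula} {τ ρ ρ' : ℕ → Move}
    (h : IsResponse f τ ρ) (h' : IsResponse f τ ρ') : ρ = ρ' := by
  funext j
  induction j using Nat.strong_induction_on with
  | _ j ih =>
    rcases Nat.even_or_odd' j with ⟨i, rfl | rfl⟩
    · rw [(h i).1, (h' i).1]
    · rw [(h i).2, (h' i).2, ih (2 * i) (by omega), initialSegment_congr ih]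

/-! ### The strategies of the two players. -/

open Formula

/-- The letters that Spoiler controls. -/
abbrev spoilerLetters : Set Formula := {ψ | ψ ∈ [mark]}

theorem mem_spoilerLetters {ψ : Formula} : ψ ∈ spoilerLetters ↔ ψ = mark := by
  simp [spoilerLetters]

theorem Formula.subformulas_subset {φ χ : Formula} (h : χ ∈ φ.subformulas) :
    χ.subformulas ⊆ φ.subformulas := by
  induction φ with
  | letter a => obtain rfl := h; exact subset_rfl
  | neg ψ ih =>
    rcases h with rfl | h
    · exact subset_rfl
    · exact (ih h).trans Set.subset_union_right
  | or ψ ψ' ih ih' =>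
    rcases h with (rfl | h) | h
    · exact subset_rfl
    · exact (ih h).trans (Set.subset_union_right.trans Set.subset_union_left)
    · exact (ih' h).trans Set.subset_union_right
  | diaA ψ ih =>
    rcases h with rfl | h
    · exact subset_rfl
    · exact (ih h).trans Set.subset_union_right
  | diaAbar ψ ih =>
    rcases h with rfl | h
    · exact subset_rfl
    · exact (ih h).trans Set.subset_union_right
  | diaB ψ ih =>
    rcases h with rfl | h
    · exact subset_rfl
    · exact (ih h).trans Set.subset_union_right
  | diaBbar ψ ih =>
    rcases h with rfl | h
    · exact subset_rfl
    · exact (ih h).trans Set.subset_union_right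

theorem Formula.not_isRequest_letter (a : ℕ) : ¬ IsRequest (letter a) := by
  rintro ⟨ψ, h | h | h | h⟩ <;> cases h

/-- Duplicator takes the letters from `W` and evaluates requests as if all intervals not yet played
were unmarked. The intervals with smaller right endpoints have been played, so by foreseeability the
declared values remain correct, in whatever order Spoiler picks the intervals. -/
theorem finiteSynthesis_of_labels {Θ : Set Formula} {φ : Formula} {k : ℕ} {W : ℕ → ℕ → Set ℕ}
    (hΘ : Θ ⊆ φ.requests) (hmark : mark ∈ φ.subformulas)
    (hφ : ∀ σ, Holds k (marked W σ) 0 0 φ) (hpre : Predictable k W φ) :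
    FiniteSynthesis Θ φ spoilerLetters := by
  classical
  set S := alphabet Θ φ with hS
  let marks : List Move → ℕ → ℕ → Prop := fun h x y =>
    ∃ e ∈ h, e.1.fst = x ∧ e.1.snd = y ∧ mark ∈ e.2
  let f : List Move → Set Formula := fun h => {ψ | ψ ∈ S \ spoilerLetters ∧ ∃ e ∈ h.getLast?,
    (∃ a, ψ = letter a ∧ a ∈ W e.1.fst e.1.snd) ∨
      (ψ ∈ Θ ∧ Holds k (marked W (marks h)) e.1.fst e.1.snd ψ)}
  refine ⟨?_, f, fun h _ ψ hψ => hψ.1, ?_⟩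
  · intro ψ hψ
    rw [mem_spoilerLetters.1 hψ]
    exact Or.inl ⟨hmark, 0, rfl⟩
  rintro τ ⟨ρ₀, hρ₀, hτ⟩
  obtain ⟨ρ, hρ⟩ := exists_eq_initialSegment fun h =>
    if Even h.length then τ (h.length / 2) else ((τ (h.length / 2)).1, f h)
  have heven : ∀ i, ρ (2 * i) = τ i := by
    intro i
    rw [hρ, length_initialSegment, if_pos (even_two_mul i), Nat.mul_div_cancel_left _ two_pos]
  have hodd : ∀ i, ρ (2 * i + 1) = ((τ i).1, f (initialSegment ρ (2 * i + 1))) := by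
    intro i
    rw [hρ, length_initialSegment, if_neg (by simp), show (2 * i + 1) / 2 = i by omega]
  have hresp : IsResponse f τ ρ := fun i => ⟨heven i, by rw [hodd, heven]⟩
  have hfst : ∀ j, (ρ j).1 = (ρ₀ j).1 := by
    intro j
    rcases Nat.even_or_odd' j with ⟨i, rfl | rfl⟩
    · rw [heven, hτ]
    · rw [hodd, hρ₀.fst_answer, hτ]
  -- The rules on intervals and on Spoiler's labels do not involve Duplicator's labels, so they are
  -- inherited from `ρ₀`.
  have hrun : InfiniteRun S spoilerLetters ρ := by
    refine ⟨⟨?_, ?_, ?_, ?_, ?_, ?_⟩, ?_⟩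
    · rw [hfst]; exact hρ₀.1.start
    · intro i hi hN
      rw [hfst, hfst]; exact hρ₀.1.answer i hi hN
    · rintro i ⟨a, rfl⟩ hN
      rw [← two_mul, heven, ← hτ]
      exact hρ₀.1.spoiler _ (even_two_mul a) (WithTop.coe_lt_top _)
    · rintro i ⟨a, rfl⟩ hN
      rw [← two_mul, hodd]
      exact fun ψ hψ => hψ.1
    · intro i j hi hN hN'
      rw [hfst, hfst]; exact hρ₀.1.once i j hi hN hN'
    · intro i hN
      simp only [hfst]; exact hρ₀.1.order i hN
    · intro I
      simp only [hfst]; exact hρ₀.2 I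
  have hspoiler : ∀ i ψ, ψ ∈ (τ i).2 → ψ = mark := by
    intro i ψ hψ
    rw [← heven] at hψ
    exact mem_spoilerLetters.1
      (hrun.1.spoiler (2 * i) (even_two_mul i) (WithTop.coe_lt_top _) hψ)
  have hf : ∀ i ψ, ψ ∈ f (initialSegment ρ (2 * i + 1)) ↔ ψ ∈ S \ spoilerLetters ∧
      ((∃ a, ψ = letter a ∧ a ∈ W (τ i).1.fst (τ i).1.snd) ∨ (ψ ∈ Θ ∧
        Holds k (marked W (marks (initialSegment ρ (2 * i + 1)))) (τ i).1.fst (τ i).1.snd ψ)) := by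
    intro i ψ
    have hlast : (initialSegment ρ (2 * i + 1)).getLast? = some (τ i) := by
      rw [← heven, initialSegment, List.range_succ, List.map_append, List.map_singleton,
        List.getLast?_append]
      rfl
    simp only [f, Set.mem_ofPred_eq, hlast, Option.mem_def, Option.some.injEq, exists_eq_left']
  let σ : ℕ → ℕ → Prop := fun x y => ∃ i, (τ i).1.fst = x ∧ (τ i).1.snd = y ∧ mark ∈ (τ i).2
  have hround : ∀ I : NonemptyInterval (Fin (k + 1)), ∃ i, (τ i).1 = toNatInterval I ∧
      ∀ ψ, ψ ∈ labelling ρ ((k + 1) * (k + 2)) (toNatInterval I) ↔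
        ψ ∈ (τ i).2 ∨ ψ ∈ f (initialSegment ρ (2 * i + 1)) := by
    intro I
    obtain ⟨i, -, hi⟩ := hrun.exists_round (k := k) (I := toNatInterval I)
      (Nat.lt_succ_iff.1 I.snd.isLt)
    refine ⟨i, by rw [← heven, hi], fun ψ => ?_⟩
    have := hrun.mem_labelling (k := k) (a := i) (by rw [hi]; exact Nat.lt_succ_iff.1 I.snd.isLt) ψ
    rwa [hi, heven, hodd] at this
  have hV : ∀ a, letter a ∈ φ.subformulas → ∀ I : NonemptyInterval (Fin (k + 1)),
      a ∈ inducedValuation ρ k I ↔ a ∈ marked W σ I.fst I.snd := by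
    intro a ha I
    obtain ⟨i, hi, hlab⟩ := hround I
    have hi1 : (τ i).1.fst = I.fst := by rw [hi]; rfl
    have hi2 : (τ i).1.snd = I.snd := by rw [hi]; rfl
    rw [inducedValuation, Set.mem_ofPred_eq, hlab, hf, hi1, hi2]
    cases a with
    | zero =>
      rw [zero_mem_marked]
      constructor
      · rintro (h | h)
        · exact ⟨i, hi1, hi2, h⟩
        · exact absurd (mem_spoilerLetters.2 rfl) h.1.2
      · rintro ⟨i', h1, h2, h⟩
        have : (ρ (2 * i')).1 = (ρ (2 * i)).1 := by
          rw [heven, heven]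
          exact NonemptyInterval.ext (Prod.ext (h1.trans hi1.symm) (h2.trans hi2.symm))
        obtain rfl := hrun.injective this
        exact Or.inl h
    | succ a =>
      rw [succ_mem_marked]
      constructor
      · rintro (h | ⟨-, ⟨b, hb, h⟩ | ⟨h, -⟩⟩)
        · exact absurd (hspoiler i _ h) (by simp)
        · obtain rfl : a + 1 = b := by simpa using hb
          exact h
        · exact absurd (hΘ h).2 (not_isRequest_letter _)
      · intro h
        refine Or.inr ⟨⟨Or.inl ⟨ha, _, rfl⟩, ?_⟩, Or.inl ⟨_, rfl, h⟩⟩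
        rw [mem_spoilerLetters]
        simp
  refine ⟨ρ, hresp, k, hrun.finiteRun k, ?_, ?_⟩
  · exact (sat_iff_holds hV _).2 (hφ σ)
  · intro I ψ hψ
    have hψ' := hΘ hψ
    obtain ⟨i, hi, hlab⟩ := hround I
    have hi1 : (τ i).1.fst = I.fst := by rw [hi]; rfl
    have hi2 : (τ i).1.snd = I.snd := by rw [hi]; rfl
    rw [sat_iff_holds (fun a ha => hV a (subformulas_subset hψ'.1 ha)) I, hlab, hf, hi1, hi2]
    -- The marks in the history and those of the whole play agree on intervals that end earlier, by
    -- `InfiniteRun.exists_lt`.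
    have hfore := hpre ψ hψ'.1 hψ'.2 σ (marks (initialSegment ρ (2 * i + 1))) I.fst I.snd
      I.fst_le_snd (Nat.lt_succ_iff.1 I.snd.isLt) (by
        intro x y hxy hy
        constructor
        · rintro ⟨i', h1, h2, h⟩
          obtain ⟨b, hb, hb'⟩ := hrun.exists_lt i (I := (τ i').1)
            (by rw [heven, hi2, h2]; exact hy)
          rw [← heven i'] at hb'
          obtain rfl := hrun.injective hb'
          exact ⟨τ b, mem_initialSegment.2 ⟨2 * b, by omega, heven b⟩, h1, h2, h⟩
        · rintro ⟨e, he, h1, h2, h⟩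
          obtain ⟨j, hj, rfl⟩ := mem_initialSegment.1 he
          rcases Nat.even_or_odd' j with ⟨b, rfl | rfl⟩
          · rw [heven] at h1 h2 h
            exact ⟨b, h1, h2, h⟩
          · rw [hodd] at h
            exact absurd (mem_spoilerLetters.2 rfl) h.1.2)
    rw [hfore]
    constructor
    · intro h
      refine Or.inr ⟨⟨Or.inr hψ, fun hm => ?_⟩, Or.inr ⟨hψ, h⟩⟩
      rw [mem_spoilerLetters.1 hm] at hψ'
      exact not_isRequest_letter _ hψ'.2
    · rintro (h | ⟨-, ⟨a, rfl, h⟩ | ⟨-, h⟩⟩)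
      · rw [hspoiler i _ h] at hψ'
        exact absurd hψ'.2 (not_isRequest_letter _)
      · exact absurd hψ'.2 (not_isRequest_letter _)
      · exact h

/-- Spoiler follows `enum` and marks `[x, y]` iff `kill` is already on some `[x', y]` with `x' < x`.
The left-to-right order of `enum` makes this playable, and it is the hypothesis on marks in
`exists_halting_of_holds_spec`. -/
theorem exists_halting_of_finiteSynthesis {Θ : Set Formula} {P : List Instr} {n : ℕ}
    (hP0 : P[0]? = some (.inc 0)) (hP1 : 1 < P.length)
    (hjump : ∀ r j, Instr.dec r j ∈ P → j ≠ 0 ∧ j ≤ P.length)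
    (h : FiniteSynthesis Θ (spec P n) spoilerLetters) :
    ∃ t, ((step P)^[t] (1, Function.update (fun _ => 0) 0 (n + 1))).1 = P.length := by
  classical
  obtain ⟨-, f, hf, hwin⟩ := h
  set S := alphabet Θ (spec P n)
  obtain ⟨ρ, hρ⟩ := exists_eq_initialSegment fun h =>
    (enum (h.length / 2), if Even h.length then {ψ | ψ = mark ∧ ∃ e ∈ h,
      e.1.snd = (enum (h.length / 2)).snd ∧ e.1.fst < (enum (h.length / 2)).fst ∧ kill ∈ e.2}
      else f h)
  have hfst : ∀ j, (ρ j).1 = enum (j / 2) := by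
    intro j
    rw [hρ, length_initialSegment]
  have heven : ∀ i, (ρ (2 * i)).2 = {ψ | ψ = mark ∧ ∃ e ∈ initialSegment ρ (2 * i),
      e.1.snd = (enum i).snd ∧ e.1.fst < (enum i).fst ∧ kill ∈ e.2} := by
    intro i
    rw [hρ, length_initialSegment, if_pos (even_two_mul i), Nat.mul_div_cancel_left _ two_pos]
  have hodd : ∀ i, (ρ (2 * i + 1)).2 = f (initialSegment ρ (2 * i + 1)) := by
    intro i
    rw [hρ, length_initialSegment, if_neg (by simp)]
  have hspoiler : ∀ i, (ρ (2 * i)).2 ⊆ spoilerLetters := by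
    intro i ψ hψ
    rw [heven] at hψ
    exact mem_spoilerLetters.2 hψ.1
  have hdup : ∀ i, (ρ (2 * i + 1)).2 ⊆ S \ spoilerLetters := by
    intro i
    induction i using Nat.strong_induction_on with
    | _ i ih =>
      rw [hodd]
      -- Strategies are constrained only at positions of admissible runs, so the play so far is
      -- completed to such a run by empty labels.
      let ρ' : ℕ → Move := fun j => if j ≤ 2 * i then ρ j else (enum (j / 2), ∅)
      have hrun : InfiniteRun S spoilerLetters ρ' := by
        refine infiniteRun_of_enum (fun j => ?_) (fun a => ?_) (fun a => ?_)
        · simp only [ρ']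
          split_ifs
          · exact hfst j
          · rfl
        · simp only [ρ']
          split_ifs
          · exact hspoiler a
          · exact Set.empty_subset _
        · simp only [ρ']
          split_ifs
          · exact ih a (by omega)
          · exact Set.empty_subset _
      refine hf _ ⟨ρ', 2 * i + 1, odd_two_mul_add_one i, initialSegment_congr fun j hj => ?_,
        Or.inl hrun⟩
      simp only [ρ']
      rw [if_pos (by omega)]
  have hrun := infiniteRun_of_enum hfst hspoiler hdup
  obtain ⟨ρ', hρ', k, -, hsat, -⟩ := hwin (fun i => ρ (2 * i)) ⟨ρ, hrun, fun _ => rfl⟩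
  obtain rfl : ρ' = ρ := hρ'.unique fun i => ⟨rfl, Prod.ext (by
    simp only [hfst]; congr 1; omega) (hodd i)⟩
  let v : ℕ → ℕ → Set ℕ := fun x y =>
    {a | ∃ h : x ≤ y, letter a ∈ labelling ρ' ((k + 1) * (k + 2)) ⟨(x, y), h⟩}
  have hspec : Holds k v 0 0 (spec P n) := by
    refine (sat_iff_holds (fun a _ I => ?_) _).1 hsat
    exact ⟨fun h => ⟨I.fst_le_snd, h⟩, fun ⟨_, h⟩ => h⟩
  have hv : ∀ x y a (hxy : x ≤ y), y ≤ k → (a ∈ v x y ↔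
      letter a ∈ (ρ' (2 * index ⟨(x, y), hxy⟩)).2 ∨
      letter a ∈ (ρ' (2 * index ⟨(x, y), hxy⟩ + 1)).2) := by
    intro x y a hxy hy
    have hI : (ρ' (2 * index ⟨(x, y), hxy⟩)).1 = ⟨(x, y), hxy⟩ := by
      rw [hfst, Nat.mul_div_cancel_left _ two_pos, enum_index]
    rw [← hrun.mem_labelling (k := k) (by rw [hI]; exact hy), hI]
    exact ⟨fun ⟨_, h⟩ => h, fun h => ⟨hxy, h⟩⟩
  refine exists_halting_of_holds_spec hP0 hP1 hjump hspec fun x y hxy hy => ?_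
  have hkill : ∀ i, kill ∉ (ρ' (2 * i)).2 := by
    intro i h
    have := mem_spoilerLetters.1 (hspoiler i h)
    simp at this
  have hmark : mark ∉ (ρ' (2 * index ⟨(x, y), hxy⟩ + 1)).2 := fun h =>
    (hdup _ h).2 (mem_spoilerLetters.2 rfl)
  rw [hv x y 0 hxy hy, or_iff_left hmark, heven, enum_index]
  constructor
  · rintro ⟨-, e, he, h1, h2, h3⟩
    obtain ⟨j, hj, rfl⟩ := mem_initialSegment.1 he
    rcases Nat.even_or_odd' j with ⟨i, rfl | rfl⟩
    · exact absurd h3 (hkill i)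
    · rw [hfst, show (2 * i + 1) / 2 = i by omega] at h1 h2
      refine ⟨(enum i).fst, h2, ?_⟩
      have hle : (enum i).fst ≤ y := by
        have := (enum i).fst_le_snd
        simp only at h1
        omega
      rw [hv _ y 1 hle hy, or_iff_right (hkill _)]
      have : (⟨((enum i).fst, y), hle⟩ : NonemptyInterval ℕ) = enum i :=
        NonemptyInterval.ext (Prod.ext rfl h1.symm)
      rwa [this, index_enum]
  · rintro ⟨x', hx', h⟩
    rw [hv x' y 1 (by omega) hy, or_iff_right (hkill _)] at h
    refine ⟨rfl, _, mem_initialSegment.2 ⟨_, ?_, rfl⟩, ?_, ?_, h⟩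
    · simp only [index]; omega
    · rw [hfst, show ∀ i, (2 * i + 1) / 2 = i by intro i; omega, enum_index]
    · rw [hfst, show ∀ i, (2 * i + 1) / 2 = i by intro i; omega, enum_index]
      exact hx'

/-! ### Computability of the reduction. -/

theorem primrec_neg : Primrec Formula.neg := by
  refine Primrec.encode_iff.1 ?_
  exact (Primrec.nat_add.comp (Primrec.nat_mul.comp (.const 7) Primrec.encode) (.const 1)).of_eq
    fun φ => rfl

theorem primrec_diaB : Primrec Formula.diaB := by
  refine Primrec.encode_iff.1 ?_
  exact (Primrec.nat_add.comp (Primrec.nat_mul.comp (.const 7) Primrec.encode) (.const 5)).of_eq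
    fun φ => rfl

theorem primrec_diaBbar : Primrec Formula.diaBbar := by
  refine Primrec.encode_iff.1 ?_
  exact (Primrec.nat_add.comp (Primrec.nat_mul.comp (.const 7) Primrec.encode) (.const 6)).of_eq
    fun φ => rfl

theorem primrec_or : Primrec₂ Formula.or := by
  refine Primrec.encode_iff.1 ?_
  exact (Primrec.nat_add.comp (Primrec.nat_mul.comp (.const 7) (Primrec₂.natPair.comp
    (Primrec.encode.comp .fst) (Primrec.encode.comp .snd))) (.const 2)).of_eq fun φ => rfl

theorem primrec_and : Primrec₂ Formula.and :=
  primrec_neg.comp (primrec_or.comp (primrec_neg.comp .fst) (primrec_neg.comp .snd))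

theorem primrec_input : Primrec Formula.input := by
  have h : ∀ j, Primrec fun n => Formula.diaB^[n + j] top := fun j =>
    Primrec.nat_iterate (Primrec.nat_add.comp .id (.const j)) (.const top)
      (primrec_diaB.comp₂ Primrec₂.right)
  exact primrec_diaBbar.comp (primrec_and.comp (h 1) (primrec_and.comp (primrec_neg.comp (h 2))
    (.const _)))

/-- As the machine is fixed, everything except `input n` is a constant formula. -/
theorem primrec_spec (P : List Instr) : Primrec (Formula.spec P) :=
  primrec_and.comp primrec_input (.const _)

/-- A primitive recursive test whether the code `v - 1` has stopped after `t` steps. -/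
theorem primrec_stopped : Primrec₂ fun v t : ℕ =>
    cond (Nat.Partrec.Code.evaln t (Denumerable.ofNat Nat.Partrec.Code (v - 1)) 0).isSome 0 1 := by
  refine Primrec.cond ?_ (.const 0) (.const 1)
  exact Primrec.option_isSome.comp (Nat.Partrec.Code.primrec_evaln.comp
    ((Primrec.snd.pair ((Primrec.ofNat Nat.Partrec.Code).comp
      (Primrec.nat_sub.comp .fst (.const 1)))).pair (.const 0)))

/-- The halting problem reduces to finite synthesis, for any choice of declared requests. -/
theorem not_computablePred_finiteSynthesis (Θ : Formula → Set Formula)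
    (hΘ : ∀ φ, Θ φ ⊆ φ.requests) : ¬ ComputablePred (fun p : Formula × List Formula =>
      FiniteSynthesis (Θ p.1) p.1 {ψ | ψ ∈ p.2}) := by
  intro hcomp
  obtain ⟨P, hP0, hP1, hjump, hP⟩ := exists_program primrec_stopped
  refine ComputablePred.halting_problem 0 (ComputablePred.computable_of_manyOneReducible
    ⟨fun c => (spec P (Encodable.encode c), [mark]), ?_, fun c => ?_⟩ hcomp)
  · exact (((primrec_spec P).comp Primrec.encode).pair (.const _)).to_comp
  · have hdom : (Nat.Partrec.Code.eval c 0).Dom ↔ ∃ t, ((step P)^[t]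
        (1, Function.update (fun _ => 0) 0 (Encodable.encode c + 1))).1 = P.length := by
      rw [hP, Part.dom_iff_mem]
      simp only [Nat.add_sub_cancel, Denumerable.ofNat_encode, Nat.Partrec.Code.evaln_complete]
      rw [exists_comm]
      refine exists_congr fun t => ?_
      rcases Nat.Partrec.Code.evaln t c 0 with _ | x <;> simp
    refine hdom.trans ?_
    constructor
    · intro h
      obtain ⟨k, W, h1, h2⟩ := exists_labels_of_halting hP0 h
      exact finiteSynthesis_of_labels (hΘ _) (mark_mem_subformulas_spec _ _) h1 h2
    · exact exists_halting_of_finiteSynthesis hP0 hP1 hjump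

end IntervalSynthesis

theorem mainTheorem3 :
    (¬ ComputablePred (fun p : IntervalSynthesis.Formula × List IntervalSynthesis.Formula =>
      IntervalSynthesis.FiniteSynthesis p.1.requests p.1 {ψ | ψ ∈ p.2})) ∧
    (¬ ComputablePred (fun p : IntervalSynthesis.Formula × List IntervalSynthesis.Formula =>
      IntervalSynthesis.FiniteSynthesis ∅ p.1 {ψ | ψ ∈ p.2})) := by
  exact ⟨IntervalSynthesis.not_computablePred_finiteSynthesis IntervalSynthesis.Formula.requests
      fun _ => subset_rfl,
    IntervalSynthesis.not_computablePred_finiteSynthesis (fun _ => ∅)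
      fun _ => Set.empty_subset _⟩
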